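/- Let $(\Omega,\mathcal A,\mu)$ be a measure space with $\mu(\Omega)=\infty$. Let $\mathbb K=\mathbb R$ or $\mathbb K=\mathbb C$, let $L^p$ ($p=1,\infty$) be the Lebesgue spaces of (classes of a.e. equal) $\mathbb K$-valued measurable functions on $\Omega$, and for $f\in L^1+L^\infty$ put $\mu_t(f)=\inf\{\lambda>0:\mu\{|f|>\lambda\}\le t\}$, $t>0$. A *fully symmetric space* is a linear subspace $E\subset L^1+L^\infty$ with a complete norm $\|\cdot\|_E$ such that, whenever $f\in E$, $g\in L^1+L^\infty$ and $\int_0^s\mu_t(g)\,dt\le\int_0^s\mu_t(f)\,dt$ for all $s>0$, one has $g\in E$ and $\|g\|_E\le\|f\|_E$. A linear operator $T:L^1+L^\infty\to L^1+L^\infty$ is a *Dunford–Schwartz operator* if $\|Tf\|_1\le\|f\|_1$ for all $f\in L^1$ and $\|Tf\|_\infty\le\|f\|_\infty$ for all $f\in L^\infty$; it is *positive* if $Tf\ge0$ whenever $f\ge0$. A sequence $\{\beta_k\}_{k\ge0}\subset\mathbb C$ is a *bounded Besicovitch sequence* if $\sup_k|\beta_k|<\infty$ and for every $\varepsilon>0$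 there is a trigonometric polynomial $P(k)=\sum_{j=1}^s z_j\lambda_j^k$ ($z_j,\lambda_j\in\mathbb C$, $|\lambda_j|=1$) with $\limsup_n\frac1n\sum_{k=0}^{n-1}|\beta_k-P(k)|<\varepsilon$. Let $E$ be a fully symmetric space with $\mathbf 1\notin E$, where $\mathbf 1$ is the constant function $1$, and suppose that either $\mathbb K=\mathbb R$ and $T$ is a Dunford–Schwartz operator, or $\mathbb K=\mathbb C$ and $T$ is a positive Dunford–Schwartz operator. Then for every $f\in E$ and every bounded Besicovitch sequence $\{\beta_k\}$ the averages $$\frac1n\sum_{k=0}^{n-1}\beta_kT^kf$$ converge $\mu$-a.e. as $n\to\infty$ to some $\widehat f$, where $\widehat f\in E$ if $\mathbb K=\mathbb C$; and if $\mathbb K=\mathbb R$, then $\widehat f=u+iv$ with $u,v\in E$, and $\widehat f=u\in E$ if all $\beta_k$ are real. -/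

import Mathlib

open MeasureTheory Filter Topology
open scoped ENNReal

noncomputable section

namespace FullySymmetric

variable {Ω : Type*} [MeasurableSpace Ω]

/-- The space `L¹ + L^∞` of classes of a.e. equal `𝕜`-valued measurable functions
(`𝕜 = ℝ` or `𝕜 = ℂ`). -/
def L1AddLinf (𝕜 : Type*) [RCLike 𝕜] (μ : Measure Ω) : Submodule 𝕜 (Ω →ₘ[μ] 𝕜) :=
  Lp.LpSubmodule 𝕜 𝕜 1 μ ⊔ Lp.LpSubmodule 𝕜 𝕜 ∞ μ

variable {𝕜 : Type*} [RCLike 𝕜] {μ : Measure Ω}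

/-- The non-increasing rearrangement `μ_t(f) = inf {l > 0 : μ{|f| > l} ≤ t}` for `t > 0`.
The infimum is taken in `[0, ∞]`; it is finite whenever `f ∈ L¹ + L^∞`. -/
def rearrangement (f : Ω →ₘ[μ] 𝕜) (t : ℝ) : ℝ≥0∞ :=
  sInf {l : ℝ≥0∞ | 0 < l ∧ μ {ω | l < ‖f ω‖ₑ} ≤ ENNReal.ofReal t}

/-- `Submajorized g f` is the relation `g ≺≺ f`:
`∫₀ˢ μ_t(g) dt ≤ ∫₀ˢ μ_t(f) dt` for all `s > 0`. -/
def Submajorized (g f : Ω →ₘ[μ] 𝕜) : Prop :=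
  ∀ s : ℝ, 0 < s →
    ∫⁻ t in Set.Ioo 0 s, rearrangement g t ≤ ∫⁻ t in Set.Ioo 0 s, rearrangement f t

/-- A fully symmetric space: a linear subspace `E` of `L¹ + L^∞` with a complete norm such that
`f ∈ E`, `g ∈ L¹ + L^∞` and `g ≺≺ f` imply `g ∈ E` and `‖g‖_E ≤ ‖f‖_E`. -/
structure FullySymmetricSpace (𝕜 : Type*) [RCLike 𝕜] (μ : Measure Ω) where
  /-- the underlying linear space -/
  carrier : Submodule 𝕜 (Ω →ₘ[μ] 𝕜)
  le_L1AddLinf : carrier ≤ L1AddLinf 𝕜 μ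
  /-- the norm -/
  nrm : Seminorm 𝕜 carrier
  eq_zero_of_nrm : ∀ f, nrm f = 0 → f = 0
  /-- every Cauchy sequence for the norm converges in the norm -/
  complete : ∀ u : ℕ → carrier,
    (∀ ε : ℝ, 0 < ε → ∃ N : ℕ, ∀ m ≥ N, ∀ n ≥ N, nrm (u m - u n) < ε) →
      ∃ f : carrier, Tendsto (fun n => nrm (u n - f)) atTop (𝓝 0)
  fully_symmetric : ∀ (f : carrier) (g : Ω →ₘ[μ] 𝕜), g ∈ L1AddLinf 𝕜 μ →
    Submajorized g (f : Ω →ₘ[μ] 𝕜) → ∃ hg : g ∈ carrier, nrm ⟨g, hg⟩ ≤ nrm f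

/-- Dunford–Schwartz operators: linear operators on `L¹ + L^∞` which are contractions for the
`L¹`-norm on `L¹` and for the `L^∞`-norm on `L^∞`. -/
def IsDunfordSchwartz (T : Module.End 𝕜 (L1AddLinf 𝕜 μ)) : Prop :=
  (∀ f : L1AddLinf 𝕜 μ, (f : Ω →ₘ[μ] 𝕜) ∈ Lp 𝕜 1 μ →
    eLpNorm (T f : Ω →ₘ[μ] 𝕜) 1 μ ≤ eLpNorm (f : Ω →ₘ[μ] 𝕜) 1 μ) ∧
  (∀ f : L1AddLinf 𝕜 μ, (f : Ω →ₘ[μ] 𝕜) ∈ Lp 𝕜 ∞ μ →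
    eLpNorm (T f : Ω →ₘ[μ] 𝕜) ∞ μ ≤ eLpNorm (f : Ω →ₘ[μ] 𝕜) ∞ μ)

/-- `f` is a.e. equal to a function with values in `[0, ∞) ⊆ 𝕜`. -/
def AENonneg (f : Ω →ₘ[μ] 𝕜) : Prop :=
  ∀ᵐ ω ∂μ, 0 ≤ RCLike.re (f ω) ∧ RCLike.im (f ω) = 0

/-- Positive operators map nonnegative functions to nonnegative functions. -/
def IsPositive (T : Module.End 𝕜 (L1AddLinf 𝕜 μ)) : Prop :=
  ∀ f : L1AddLinf 𝕜 μ, AENonneg (f : Ω →ₘ[μ] 𝕜) → AENonneg (T f : Ω →ₘ[μ] 𝕜)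

/-- Trigonometric polynomials `P(k) = ∑ⱼ zⱼ λⱼᵏ`, `k ∈ ℤ`, with `zⱼ ∈ ℂ` and `|λⱼ| = 1`. -/
def IsTrigPolynomial (P : ℤ → ℂ) : Prop :=
  ∃ (s : ℕ) (z : Fin s → ℂ) (l : Fin s → Circle), ∀ k : ℤ, P k = ∑ j, z j * (l j : ℂ) ^ k

/-- Bounded Besicovitch sequences. (The `limsup` is that of a bounded sequence of reals.) -/
def IsBoundedBesicovitch (β : ℕ → ℂ) : Prop :=
  (∃ C : ℝ, ∀ k, ‖β k‖ ≤ C) ∧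
  ∀ ε : ℝ, 0 < ε → ∃ P : ℤ → ℂ, IsTrigPolynomial P ∧
    limsup (fun n : ℕ => (1 / (n : ℝ)) * ∑ k ∈ Finset.range n, ‖β k - P k‖) atTop < ε

/-- The weighted averages `(1/n) ∑_{k<n} β_k x_k` of a sequence of numbers. -/
def weightedAverage (β x : ℕ → ℂ) (n : ℕ) : ℂ :=
  (1 / (n : ℂ)) * ∑ k ∈ Finset.range n, β k * x k

end FullySymmetric

end

open MeasureTheory Filter Topology
open scoped ENNReal

noncomputable section

namespace FullySymmetric

variable {Ω : Type*} [MeasurableSpace Ω] {𝕜 : Type*} [RCLike 𝕜] {μ : Measure Ω}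

/-! Since `1` is not in `E`, every f in `E` has level sets {|f| > a} of finite measure: otherwise 1
≺≺ f/a. Hence f is, for every a > 0, the sum of an integrable function and a function bounded by a,
and a.e. convergence for f follows from convergence on bounded functions in L² together with a
maximal inequality.

The maximal inequality is of weak type (1, 1) and bounds the sums of |Tᵏ f|. It comes from Chacon's
filling scheme. In place of the linear modulus of `T`, it uses that `T` preserves a bound ∑ |dᵢ| ≤ a
on finite families (`ae_sum_norm_le`). The same fact, with Cauchy–Schwarz, makes `T` a contraction
on L² (`eLpNorm_two_le`).

On L² × L² the operator `T` followed by a rotation of angle θ is again a contraction. By the mean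
ergodic theorem (x, 0) is a fixed vector plus a coboundary plus a small remainder. The averages of
the first two parts converge a.e., and the maximal inequality controls the third. The two
coordinates of the orbit carry the weights cos (kθ) and sin (kθ), which gives trigonometric
polynomials over ℝ and ℂ alike. On bounded orbits approximation of the weights then gives
Besicovitch sequences (`ae_exists_tendsto_realAverage`).

The limit g lies in `E` because g ≺≺ f once the weights are normalized to |αₖ| ≤ 1. Softly truncate
f at the level m = μ_s(f), so that f = v + h with |v| ≤ m. The limits of the two parts obey the same
L^∞ and L¹ bounds, so ∫₀ˢ μ_t(g) dt ≤ ‖h‖₁ + s m ≤ ∫₀ˢ μ_t(f) dt (`exists_limit_mem`). Complex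
weights are split into real and imaginary parts. -/

/-! ### The space L¹ + L^∞ -/

theorem mem_L1AddLinf_of_memLp_one {f : Ω →ₘ[μ] 𝕜} (hf : MemLp f 1 μ) : f ∈ L1AddLinf 𝕜 μ :=
  Submodule.mem_sup_left (Lp.mem_Lp_iff_memLp.2 hf)

theorem mem_L1AddLinf_of_memLp_top {f : Ω →ₘ[μ] 𝕜} (hf : MemLp f ∞ μ) : f ∈ L1AddLinf 𝕜 μ :=
  Submodule.mem_sup_right (Lp.mem_Lp_iff_memLp.2 hf)

theorem exists_add_of_mem_L1AddLinf {f : Ω →ₘ[μ] 𝕜} (hf : f ∈ L1AddLinf 𝕜 μ) :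
    ∃ a b : Ω →ₘ[μ] 𝕜, MemLp a 1 μ ∧ MemLp b ∞ μ ∧ a + b = f := by
  obtain ⟨a, ha, b, hb, h⟩ := Submodule.mem_sup.1 hf
  exact ⟨a, b, Lp.mem_Lp_iff_memLp.1 ha, Lp.mem_Lp_iff_memLp.1 hb, h⟩

/-- `L¹ + L^∞` is a solid space. -/
theorem mem_L1AddLinf_of_norm_le {f g : Ω →ₘ[μ] 𝕜} (hf : f ∈ L1AddLinf 𝕜 μ)
    (hgf : ∀ᵐ ω ∂μ, ‖g ω‖ ≤ ‖f ω‖) : g ∈ L1AddLinf 𝕜 μ := by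
  obtain ⟨a, b, ha, hb, hab⟩ := exists_add_of_mem_L1AddLinf hf
  -- The quotient g / f is a measurable multiplier of modulus at most 1, with 0 / 0 = 0. Multiplying
  -- both summands of f = a + b by it decomposes g.
  have hm : AEStronglyMeasurable (fun ω => g ω / f ω) μ :=
    (g.aemeasurable.div f.aemeasurable).aestronglyMeasurable
  have hφ : ∀ᵐ ω ∂μ, ‖g ω / f ω‖ ≤ 1 := by
    filter_upwards [hgf] with ω h
    rw [norm_div]
    exact div_le_one_of_le₀ h (norm_nonneg _)
  have key : ∀ {p : ℝ≥0∞} {c : Ω →ₘ[μ] 𝕜}, MemLp c p μ →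
      MemLp (fun ω => g ω / f ω * c ω) p μ := by
    intro p c hc
    refine hc.of_le (hm.mul c.aestronglyMeasurable) ?_
    filter_upwards [hφ] with ω h
    rw [norm_mul]
    exact mul_le_of_le_one_left (norm_nonneg _) h
  have h1 := key ha
  have h2 := key hb
  have hg : g = AEEqFun.mk _ h1.1 + AEEqFun.mk _ h2.1 := by
    apply AEEqFun.ext
    filter_upwards [AEEqFun.coeFn_add (AEEqFun.mk _ h1.1) (AEEqFun.mk _ h2.1),
      AEEqFun.coeFn_mk _ h1.1, AEEqFun.coeFn_mk _ h2.1, hgf, AEEqFun.coeFn_add a b]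
      with ω e1 e2 e3 h e4
    rw [e1, Pi.add_apply, e2, e3, ← mul_add]
    rw [hab, Pi.add_apply] at e4
    rw [← e4]
    by_cases h0 : f ω = 0
    · rw [h0, norm_zero, norm_le_zero_iff] at h
      simp [h, h0]
    · rw [div_mul_cancel₀ _ h0]
  rw [hg]
  exact Submodule.add_mem _
    (mem_L1AddLinf_of_memLp_one ((memLp_congr_ae (AEEqFun.coeFn_mk _ h1.1)).2 h1))
    (mem_L1AddLinf_of_memLp_top ((memLp_congr_ae (AEEqFun.coeFn_mk _ h2.1)).2 h2))

theorem exists_coeFn_eq (x : L1AddLinf 𝕜 μ) {g : Ω → 𝕜} (hg : AEStronglyMeasurable g μ)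
    (hgx : ∀ᵐ ω ∂μ, ‖g ω‖ ≤ ‖(x : Ω →ₘ[μ] 𝕜) ω‖) :
    ∃ y : L1AddLinf 𝕜 μ, (y : Ω →ₘ[μ] 𝕜) =ᵐ[μ] g := by
  refine ⟨⟨AEEqFun.mk g hg, mem_L1AddLinf_of_norm_le x.2 ?_⟩, AEEqFun.coeFn_mk g hg⟩
  filter_upwards [hgx, AEEqFun.coeFn_mk g hg] with ω h e
  rwa [e]

theorem exists_coeFn_eq_of_memLp_top {g : Ω → 𝕜} (hg : MemLp g ∞ μ) :
    ∃ y : L1AddLinf 𝕜 μ, (y : Ω →ₘ[μ] 𝕜) =ᵐ[μ] g :=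
  ⟨⟨AEEqFun.mk g hg.1, mem_L1AddLinf_of_memLp_top
    ((memLp_congr_ae (AEEqFun.coeFn_mk _ hg.1)).2 hg)⟩, AEEqFun.coeFn_mk g hg.1⟩

theorem exists_coeFn_eq_of_memLp_one {g : Ω → 𝕜} (hg : MemLp g 1 μ) :
    ∃ y : L1AddLinf 𝕜 μ, (y : Ω →ₘ[μ] 𝕜) =ᵐ[μ] g :=
  ⟨⟨AEEqFun.mk g hg.1, mem_L1AddLinf_of_memLp_one
    ((memLp_congr_ae (AEEqFun.coeFn_mk _ hg.1)).2 hg)⟩, AEEqFun.coeFn_mk g hg.1⟩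

theorem ext_ae {x y : L1AddLinf 𝕜 μ} (h : (x : Ω →ₘ[μ] 𝕜) =ᵐ[μ] (y : Ω →ₘ[μ] 𝕜)) : x = y :=
  Subtype.ext (AEEqFun.ext h)

theorem coeFn_add_ae (x y : L1AddLinf 𝕜 μ) :
    ∀ᵐ ω ∂μ, ((x + y : L1AddLinf 𝕜 μ) : Ω →ₘ[μ] 𝕜) ω
      = (x : Ω →ₘ[μ] 𝕜) ω + (y : Ω →ₘ[μ] 𝕜) ω := AEEqFun.coeFn_add _ _

theorem coeFn_sub_ae (x y : L1AddLinf 𝕜 μ) :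
    ∀ᵐ ω ∂μ, ((x - y : L1AddLinf 𝕜 μ) : Ω →ₘ[μ] 𝕜) ω
      = (x : Ω →ₘ[μ] 𝕜) ω - (y : Ω →ₘ[μ] 𝕜) ω := AEEqFun.coeFn_sub _ _

theorem coeFn_smul_ae (c : 𝕜) (x : L1AddLinf 𝕜 μ) :
    ∀ᵐ ω ∂μ, ((c • x : L1AddLinf 𝕜 μ) : Ω →ₘ[μ] 𝕜) ω = c * (x : Ω →ₘ[μ] 𝕜) ω :=
  AEEqFun.coeFn_smul _ _

theorem coeFn_sum_ae {ι : Type*} (s : Finset ι) (x : ι → L1AddLinf 𝕜 μ) :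
    ∀ᵐ ω ∂μ, ((∑ i ∈ s, x i : L1AddLinf 𝕜 μ) : Ω →ₘ[μ] 𝕜) ω
      = ∑ i ∈ s, (x i : Ω →ₘ[μ] 𝕜) ω := by
  classical
  induction s using Finset.induction_on with
  | empty => exact AEEqFun.coeFn_zero
  | insert a s ha ih =>
    filter_upwards [ih, coeFn_add_ae (x a) (∑ i ∈ s, x i)] with ω h1 h2
    rw [Finset.sum_insert ha, Finset.sum_insert ha, h2, h1]

/-! ### Dunford–Schwartz operators and finite families -/

namespace IsDunfordSchwartz

variable {T : Module.End 𝕜 (L1AddLinf 𝕜 μ)}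

theorem eLpNorm_one_le (hT : IsDunfordSchwartz T) (x : L1AddLinf 𝕜 μ) :
    eLpNorm (T x : Ω →ₘ[μ] 𝕜) 1 μ ≤ eLpNorm (x : Ω →ₘ[μ] 𝕜) 1 μ := by
  by_cases h : eLpNorm (x : Ω →ₘ[μ] 𝕜) 1 μ = ∞
  · exact h ▸ le_top
  · exact hT.1 x (Lp.mem_Lp_iff_eLpNorm_lt_top.2 (lt_top_iff_ne_top.2 h))

theorem eLpNorm_top_le (hT : IsDunfordSchwartz T) (x : L1AddLinf 𝕜 μ) :
    eLpNorm (T x : Ω →ₘ[μ] 𝕜) ∞ μ ≤ eLpNorm (x : Ω →ₘ[μ] 𝕜) ∞ μ := by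
  by_cases h : eLpNorm (x : Ω →ₘ[μ] 𝕜) ∞ μ = ∞
  · rw [h]
    exact le_top
  · exact hT.2 x (Lp.mem_Lp_iff_eLpNorm_lt_top.2 (lt_top_iff_ne_top.2 h))

theorem pow (hT : IsDunfordSchwartz T) (n : ℕ) : IsDunfordSchwartz (T ^ n) := by
  induction n with
  | zero => exact ⟨fun f _ => le_rfl, fun f _ => le_rfl⟩
  | succ n ih =>
    rw [pow_succ']
    exact ⟨fun f _ => (hT.eLpNorm_one_le _).trans (ih.eLpNorm_one_le f),
      fun f _ => (hT.eLpNorm_top_le _).trans (ih.eLpNorm_top_le f)⟩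

theorem lintegral_enorm_le (hT : IsDunfordSchwartz T) (x : L1AddLinf 𝕜 μ) :
    ∫⁻ ω, ‖(T x : Ω →ₘ[μ] 𝕜) ω‖ₑ ∂μ ≤ ∫⁻ ω, ‖(x : Ω →ₘ[μ] 𝕜) ω‖ₑ ∂μ := by
  simpa only [eLpNorm_one_eq_lintegral_enorm] using hT.eLpNorm_one_le x

theorem ae_norm_le (hT : IsDunfordSchwartz T) {x : L1AddLinf 𝕜 μ} {a : ℝ}
    (hx : ∀ᵐ ω ∂μ, ‖(x : Ω →ₘ[μ] 𝕜) ω‖ ≤ a) : ∀ᵐ ω ∂μ, ‖(T x : Ω →ₘ[μ] 𝕜) ω‖ ≤ a := by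
  rcases eq_or_ne μ 0 with rfl | hμ
  · simp
  have : (ae μ).NeBot := ae_neBot.2 hμ
  have ha : 0 ≤ a := by
    obtain ⟨ω, hω⟩ := hx.exists
    exact (norm_nonneg _).trans hω
  have h1 : eLpNorm (T x : Ω →ₘ[μ] 𝕜) ∞ μ ≤ ENNReal.ofReal a := by
    refine (hT.eLpNorm_top_le x).trans ?_
    rw [eLpNorm_exponent_top]
    exact eLpNormEssSup_le_of_ae_bound hx
  rw [eLpNorm_exponent_top] at h1
  filter_upwards [ae_le_eLpNormEssSup (f := (T x : Ω →ₘ[μ] 𝕜)) (μ := μ)] with ω hω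
  have := hω.trans h1
  rwa [← ofReal_norm, ENNReal.ofReal_le_ofReal_iff ha] at this

/-- A Dunford–Schwartz operator maps a finite family with `∑ |dᵢ| ≤ a` to such a family. -/
theorem ae_sum_norm_le (hT : IsDunfordSchwartz T) {ι : Type*} [Fintype ι]
    {d : ι → L1AddLinf 𝕜 μ} {a : ℝ}
    (hd : ∀ᵐ ω ∂μ, ∑ i, ‖(d i : Ω →ₘ[μ] 𝕜) ω‖ ≤ a) :
    ∀ᵐ ω ∂μ, ∑ i, ‖(T (d i) : Ω →ₘ[μ] 𝕜) ω‖ ≤ a := by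
  have : Nonempty (ι → Metric.closedBall (0 : 𝕜) 1) := ⟨fun _ => ⟨0, by simp⟩⟩
  -- For fixed multipliers cᵢ in the unit ball, |∑ cᵢ T dᵢ| = |T (∑ cᵢ dᵢ)| ≤ a off a null set
  -- depending on c. A countable dense set of multipliers yields one null set for all of them.
  set e := TopologicalSpace.denseSeq (ι → Metric.closedBall (0 : 𝕜) 1) with he
  have key : ∀ n, ∀ᵐ ω ∂μ, ‖∑ i, (e n i : 𝕜) * (T (d i) : Ω →ₘ[μ] 𝕜) ω‖ ≤ a := by
    intro n
    have h1 : ∀ᵐ ω ∂μ, ‖((∑ i, (e n i : 𝕜) • d i : L1AddLinf 𝕜 μ) : Ω →ₘ[μ] 𝕜) ω‖ ≤ a := by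
      filter_upwards [hd, coeFn_sum_ae Finset.univ fun i => (e n i : 𝕜) • d i,
        ae_all_iff.2 fun i => coeFn_smul_ae (e n i : 𝕜) (d i)] with ω h1 h2 h3
      rw [h2]
      refine (norm_sum_le _ _).trans ((Finset.sum_le_sum fun i _ => ?_).trans h1)
      rw [h3, norm_mul]
      exact mul_le_of_le_one_left (norm_nonneg _) (mem_closedBall_zero_iff.1 (e n i).2)
    have h2 := hT.ae_norm_le h1
    rw [map_sum] at h2
    simp only [map_smul] at h2
    filter_upwards [h2, coeFn_sum_ae Finset.univ fun i => (e n i : 𝕜) • T (d i),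
        ae_all_iff.2 fun i => coeFn_smul_ae (e n i : 𝕜) (T (d i))] with ω h1 h2 h3
    simpa only [h2, h3] using h1
  filter_upwards [ae_all_iff.2 key] with ω hω
  set z : ι → 𝕜 := fun i => (T (d i) : Ω →ₘ[μ] 𝕜) ω with hz
  have hall : ∀ c : ι → Metric.closedBall (0 : 𝕜) 1, ‖∑ i, (c i : 𝕜) * z i‖ ≤ a := by
    have hcl : IsClosed {c : ι → Metric.closedBall (0 : 𝕜) 1 | ‖∑ i, (c i : 𝕜) * z i‖ ≤ a} :=
      isClosed_le (by fun_prop) continuous_const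
    intro c
    have := hcl.closure_subset_iff.2 (Set.range_subset_iff.2 hω)
    exact this (TopologicalSpace.denseRange_denseSeq _ c)
  -- These multipliers turn the sum into ∑ |zᵢ|; a vanishing zᵢ gets the multiplier 0 / 0 = 0.
  have := hall fun i => ⟨star (z i) / (‖z i‖ : 𝕜), by
    rw [mem_closedBall_zero_iff, norm_div, norm_star, RCLike.norm_ofReal, abs_norm]
    exact div_self_le_one _⟩
  have h2 : ∀ i, star (z i) / (‖z i‖ : 𝕜) * z i = (‖z i‖ : 𝕜) := by
    intro i
    by_cases h0 : z i = 0
    · simp [h0]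
    · have : (‖z i‖ : 𝕜) ≠ 0 := by simpa using h0
      rw [div_mul_eq_mul_div, RCLike.star_def, RCLike.conj_mul, pow_two,
        mul_div_cancel_right₀ _ this]
  simp only [h2] at this
  rw [← RCLike.ofReal_sum, RCLike.norm_ofReal] at this
  exact (le_abs_self _).trans this

end IsDunfordSchwartz

/-! ### The filling scheme -/

/-- One step of the filling scheme: `r` is split into a part `d` that can be deposited on top
of `c` without exceeding the level `a`, and a remainder `h` that lives where the level is
reached. -/
theorem exists_filling_step {a : ℝ} (r : L1AddLinf 𝕜 μ) (c : Ω →ₘ[μ] ℝ)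
    (hc : ∀ᵐ ω ∂μ, c ω ≤ a) :
    ∃ (d h : L1AddLinf 𝕜 μ) (c' : Ω →ₘ[μ] ℝ), r = d + h ∧
      (∀ᵐ ω ∂μ, c' ω = c ω + ‖(d : Ω →ₘ[μ] 𝕜) ω‖) ∧ (∀ᵐ ω ∂μ, c' ω ≤ a) ∧
      (∀ᵐ ω ∂μ, (h : Ω →ₘ[μ] 𝕜) ω ≠ 0 → c' ω = a) ∧
      ∀ᵐ ω ∂μ, ‖(r : Ω →ₘ[μ] 𝕜) ω‖ =
        ‖(d : Ω →ₘ[μ] 𝕜) ω‖ + ‖(h : Ω →ₘ[μ] 𝕜) ω‖ := by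
  set R : Ω → 𝕜 := ⇑(r : Ω →ₘ[μ] 𝕜) with hR
  have hRm : AEStronglyMeasurable R μ := AEEqFun.aestronglyMeasurable _
  -- The fraction of R that still fits under the level a. A real factor in [0, 1] keeps the phase,
  -- so the norms of deposit and remainder add up to |R|. Where R = 0 the fraction is 0, which is
  -- harmless.
  set φ : Ω → ℝ := fun ω => min ‖R ω‖ (a - c ω) / ‖R ω‖ with hφ
  have hφm : AEStronglyMeasurable φ μ :=
    ((hRm.norm.aemeasurable.min (aemeasurable_const.sub c.aemeasurable)).div
      hRm.norm.aemeasurable).aestronglyMeasurable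
  have hφm' : AEStronglyMeasurable (fun ω => (φ ω : 𝕜)) μ :=
    RCLike.continuous_ofReal.comp_aestronglyMeasurable hφm
  have h0 : ∀ᵐ ω ∂μ, 0 ≤ φ ω := by
    filter_upwards [hc] with ω h
    exact div_nonneg (le_min (norm_nonneg _) (sub_nonneg.2 h)) (norm_nonneg _)
  have h1 : ∀ ω, φ ω ≤ 1 := fun ω => div_le_one_of_le₀ (min_le_left _ _) (norm_nonneg _)
  have hnd : ∀ᵐ ω ∂μ, ‖(φ ω : 𝕜) * R ω‖ = min ‖R ω‖ (a - c ω) := by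
    filter_upwards [h0, hc] with ω hω h
    rw [norm_mul, RCLike.norm_ofReal, abs_of_nonneg hω]
    by_cases hz : ‖R ω‖ = 0
    · rw [hz, mul_zero, min_eq_left (sub_nonneg.2 h)]
    · exact div_mul_cancel₀ _ hz
  obtain ⟨d, hd⟩ := exists_coeFn_eq r (hφm'.mul hRm) (by
    filter_upwards [hnd] with ω hω
    simpa only [Pi.mul_apply, hω] using min_le_left _ _)
  refine ⟨d, r - d, AEEqFun.mk (fun ω => c ω + ‖(d : Ω →ₘ[μ] 𝕜) ω‖)
    (c.aestronglyMeasurable.add (AEEqFun.aestronglyMeasurable _).norm), by abel,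
    AEEqFun.coeFn_mk _ _, ?_, ?_, ?_⟩
  · filter_upwards [AEEqFun.coeFn_mk (μ := μ) (fun ω => c ω + ‖(d : Ω →ₘ[μ] 𝕜) ω‖)
      (c.aestronglyMeasurable.add (AEEqFun.aestronglyMeasurable _).norm), hd, hnd] with ω e1 e2 e3
    rw [e1, e2, Pi.mul_apply, e3]
    linarith [min_le_right ‖R ω‖ (a - c ω)]
  · filter_upwards [AEEqFun.coeFn_mk (μ := μ) (fun ω => c ω + ‖(d : Ω →ₘ[μ] 𝕜) ω‖)
      (c.aestronglyMeasurable.add (AEEqFun.aestronglyMeasurable _).norm), hd, hnd, coeFn_sub_ae r d]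
      with ω e1 e2 e3 e4 hne
    rw [e1, e2, Pi.mul_apply, e3]
    rcases le_total ‖R ω‖ (a - c ω) with h | h
    · refine absurd ?_ hne
      rw [e4, e2, Pi.mul_apply]
      by_cases hz : ‖R ω‖ = 0
      · have : R ω = 0 := norm_eq_zero.1 hz
        change R ω - _ = 0
        rw [this, mul_zero, sub_self]
      · have : φ ω = 1 := by simp only [hφ, min_eq_left h, div_self hz]
        change R ω - _ = 0
        rw [this, RCLike.ofReal_one, one_mul, sub_self]
    · rw [min_eq_right h]
      ring
  · filter_upwards [hd, h0, coeFn_sub_ae r d] with ω e2 e3 e4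
    rw [e4, e2, Pi.mul_apply]
    change ‖R ω‖ = _ + ‖R ω - _‖
    have : R ω - (φ ω : 𝕜) * R ω = ((1 - φ ω : ℝ) : 𝕜) * R ω := by
      push_cast
      ring
    rw [this, norm_mul, norm_mul, RCLike.norm_ofReal, RCLike.norm_ofReal, abs_of_nonneg e3,
      abs_of_nonneg (sub_nonneg.2 (h1 ω))]
    ring

/-- The filling scheme of Chacon for an orbit of a linear operator. -/
theorem exists_filling (T : Module.End 𝕜 (L1AddLinf 𝕜 μ)) (f : L1AddLinf 𝕜 μ) {a : ℝ}
    (ha : 0 ≤ a) :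
    ∃ (r d h : ℕ → L1AddLinf 𝕜 μ), r 0 = f ∧ (∀ k, r (k + 1) = T (h k)) ∧
      (∀ k, r k = d k + h k) ∧
      (∀ k, ∀ᵐ ω ∂μ, ∑ j ∈ Finset.range k, ‖(d j : Ω →ₘ[μ] 𝕜) ω‖ ≤ a) ∧
      (∀ k, ∀ᵐ ω ∂μ, (h k : Ω →ₘ[μ] 𝕜) ω ≠ 0 →
        ∑ j ∈ Finset.range (k + 1), ‖(d j : Ω →ₘ[μ] 𝕜) ω‖ = a) ∧
      ∀ k, ∀ᵐ ω ∂μ, ‖(r k : Ω →ₘ[μ] 𝕜) ω‖ =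
        ‖(d k : Ω →ₘ[μ] 𝕜) ω‖ + ‖(h k : Ω →ₘ[μ] 𝕜) ω‖ := by
  have step := fun (p : L1AddLinf 𝕜 μ × {c : Ω →ₘ[μ] ℝ // ∀ᵐ ω ∂μ, c ω ≤ a}) =>
    exists_filling_step p.1 p.2.1 p.2.2
  choose D H C' hr hC' hle hne hnorm using step
  let s : ℕ → L1AddLinf 𝕜 μ × {c : Ω →ₘ[μ] ℝ // ∀ᵐ ω ∂μ, c ω ≤ a} := fun n =>
    Nat.rec (f, ⟨0, by
      filter_upwards [AEEqFun.coeFn_zero (μ := μ) (β := ℝ)] with ω h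
      rwa [h]⟩) (fun _ p => (T (H p), ⟨C' p, hle p⟩)) n
  have hs : ∀ k, ∀ᵐ ω ∂μ, (s k).2.1 ω
      = ∑ j ∈ Finset.range k, ‖(D (s j) : Ω →ₘ[μ] 𝕜) ω‖ := by
    intro k
    induction k with
    | zero => exact AEEqFun.coeFn_zero
    | succ k ih =>
      filter_upwards [ih, hC' (s k)] with ω h1 h2
      rw [Finset.sum_range_succ, ← h1]
      exact h2
  refine ⟨fun k => (s k).1, fun k => D (s k), fun k => H (s k), rfl, fun k => rfl,
    fun k => hr (s k), fun k => ?_, fun k => ?_, fun k => hnorm (s k)⟩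
  · filter_upwards [hs k, (s k).2.2] with ω h1 h2
    rwa [← h1]
  · filter_upwards [hs (k + 1), hne (s k)] with ω h1 h2 h3
    rw [← h1]
    exact h2 h3

/-- The orbit is the sum of the orbits of the deposits, up to the remainder. -/
theorem pow_apply_eq_sum_filling {T : Module.End 𝕜 (L1AddLinf 𝕜 μ)}
    {r d h : ℕ → L1AddLinf 𝕜 μ} (hr : ∀ k, r (k + 1) = T (h k)) (hrd : ∀ k, r k = d k + h k)
    (k : ℕ) : (T ^ k) (r 0) = ∑ j ∈ Finset.range (k + 1), (T ^ (k - j)) (d j) + h k := by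
  induction k with
  | zero => simpa using hrd 0
  | succ k ih =>
    rw [pow_succ', Module.End.mul_apply, ih, map_add, ← hr, hrd (k + 1), ← add_assoc,
      Finset.sum_range_succ _ (k + 1), map_sum, Nat.sub_self, pow_zero, Module.End.one_apply]
    congr 2
    refine Finset.sum_congr rfl fun j hj => ?_
    rw [← Module.End.mul_apply, ← pow_succ',
      Nat.succ_sub (Nat.lt_succ_iff.1 (Finset.mem_range.1 hj))]

/-! ### The maximal inequality of weak type (1, 1) -/

namespace IsDunfordSchwartz

variable {T : Module.End 𝕜 (L1AddLinf 𝕜 μ)}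

/-- The mass of the deposits of the filling scheme is bounded by the mass of `r 0`. -/
theorem sum_lintegral_filling_le (hT : IsDunfordSchwartz T) {r d h : ℕ → L1AddLinf 𝕜 μ}
    (hr : ∀ k, r (k + 1) = T (h k))
    (hnorm : ∀ k, ∀ᵐ ω ∂μ, ‖(r k : Ω →ₘ[μ] 𝕜) ω‖ =
        ‖(d k : Ω →ₘ[μ] 𝕜) ω‖ + ‖(h k : Ω →ₘ[μ] 𝕜) ω‖) (k : ℕ) :
    ∑ j ∈ Finset.range k, ∫⁻ ω, ‖(d j : Ω →ₘ[μ] 𝕜) ω‖ₑ ∂μ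
      + ∫⁻ ω, ‖(r k : Ω →ₘ[μ] 𝕜) ω‖ₑ ∂μ ≤ ∫⁻ ω, ‖(r 0 : Ω →ₘ[μ] 𝕜) ω‖ₑ ∂μ := by
  induction k with
  | zero => simp
  | succ k ih =>
    refine le_trans ?_ ih
    have h1 : ∫⁻ ω, ‖(r k : Ω →ₘ[μ] 𝕜) ω‖ₑ ∂μ = ∫⁻ ω, ‖(d k : Ω →ₘ[μ] 𝕜) ω‖ₑ ∂μ
        + ∫⁻ ω, ‖(h k : Ω →ₘ[μ] 𝕜) ω‖ₑ ∂μ := by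
      rw [← lintegral_add_left' (AEEqFun.aestronglyMeasurable _).enorm]
      refine lintegral_congr_ae ?_
      filter_upwards [hnorm k] with ω e
      rw [← ofReal_norm, e, ENNReal.ofReal_add (norm_nonneg _) (norm_nonneg _), ofReal_norm,
        ofReal_norm]
    rw [h1, Finset.sum_range_succ, add_assoc, hr]
    exact add_le_add_right (add_le_add_right (hT.lintegral_enorm_le _) _) _

/-- The maximal ergodic inequality of weak type `(1, 1)`, for the sums of `|Tᵏ f|`. -/
theorem measure_sum_norm_pow_gt_le (hT : IsDunfordSchwartz T) (f : L1AddLinf 𝕜 μ) {a : ℝ}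
    (ha : 0 < a) :
    μ {ω | ∃ n : ℕ, n * a < ∑ k ∈ Finset.range n, ‖((T ^ k) f : Ω →ₘ[μ] 𝕜) ω‖}
      ≤ eLpNorm (f : Ω →ₘ[μ] 𝕜) 1 μ / ENNReal.ofReal a := by
  obtain ⟨r, d, h, hr0, hr, hrd, hle, hne, hnorm⟩ := exists_filling T f ha.le
  -- B k is where the first k deposits have reached the level a. The deposits have total mass at
  -- most ‖f‖₁, so Markov's inequality bounds its measure. Off the union no remainder h k survives.
  set B : ℕ → Set Ω := fun k =>
    {ω | ENNReal.ofReal a ≤ ∑ j ∈ Finset.range k, ‖(d j : Ω →ₘ[μ] 𝕜) ω‖ₑ} with hB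
  have hmono : Monotone B := fun k l hkl ω hω =>
    le_trans (α := ℝ≥0∞) hω (Finset.sum_le_sum_of_subset (Finset.range_mono hkl))
  have hμB : ∀ k, μ (B k) ≤ eLpNorm (f : Ω →ₘ[μ] 𝕜) 1 μ / ENNReal.ofReal a := by
    intro k
    refine (meas_ge_le_lintegral_div ?_ (by simpa using ha) ENNReal.ofReal_ne_top).trans ?_
    · exact Finset.aemeasurable_fun_sum _ fun j _ => (AEEqFun.aestronglyMeasurable _).enorm
    · rw [lintegral_finsetSum' _ fun j _ => (AEEqFun.aestronglyMeasurable _).enorm,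
        eLpNorm_one_eq_lintegral_enorm, ← hr0]
      gcongr
      exact le_self_add.trans (hT.sum_lintegral_filling_le hr hnorm k)
  have hU : μ (⋃ k, B k) ≤ eLpNorm (f : Ω →ₘ[μ] 𝕜) 1 μ / ENNReal.ofReal a := by
    rw [hmono.measure_iUnion]
    exact iSup_le hμB
  refine (measure_mono_ae ?_).trans hU
  -- Every power of T keeps the total deposit below a. This replaces domination by a positive
  -- operator.
  have hsum : ∀ i n, ∀ᵐ ω ∂μ, ∑ j ∈ Finset.range n, ‖((T ^ i) (d j) : Ω →ₘ[μ] 𝕜) ω‖ ≤ a := by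
    intro i n
    have := (hT.pow i).ae_sum_norm_le (d := fun j : Fin n => d j) (a := a) (by
      filter_upwards [hle n] with ω hω
      rwa [Fin.sum_univ_eq_sum_range (fun j => ‖(d j : Ω →ₘ[μ] 𝕜) ω‖) n])
    filter_upwards [this] with ω hω
    rwa [Fin.sum_univ_eq_sum_range (fun j => ‖((T ^ i) (d j) : Ω →ₘ[μ] 𝕜) ω‖) n] at hω
  have hdec : ∀ k, ∀ᵐ ω ∂μ, ((T ^ k) f : Ω →ₘ[μ] 𝕜) ω =
      ∑ j ∈ Finset.range (k + 1), ((T ^ (k - j)) (d j) : Ω →ₘ[μ] 𝕜) ω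
        + (h k : Ω →ₘ[μ] 𝕜) ω := by
    intro k
    rw [← hr0, pow_apply_eq_sum_filling hr hrd k]
    filter_upwards [coeFn_add_ae (∑ j ∈ Finset.range (k + 1), (T ^ (k - j)) (d j)) (h k),
      coeFn_sum_ae (Finset.range (k + 1)) fun j => (T ^ (k - j)) (d j)] with ω e1 e2
    rw [e1, e2]
  filter_upwards [ae_all_iff.2 fun i => ae_all_iff.2 (hsum i), ae_all_iff.2 hdec,
    ae_all_iff.2 hne] with ω hs hd hn
  rintro ⟨n, hω⟩
  by_contra hcon
  have hz : ∀ k, (h k : Ω →ₘ[μ] 𝕜) ω = 0 := by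
    intro k
    by_contra hk
    refine hcon (Set.mem_iUnion.2 ⟨k + 1, ?_⟩)
    rw [hB, Set.mem_ofPred_eq, ← hn k hk, ENNReal.ofReal_sum_of_nonneg fun _ _ => norm_nonneg _]
    simp only [ofReal_norm, le_refl]
  refine hω.not_ge ?_
  -- Grouping the terms T^(k - j) (d j) by the exponent i = k - j gives at most n groups, each of
  -- total size at most a.
  calc ∑ k ∈ Finset.range n, ‖((T ^ k) f : Ω →ₘ[μ] 𝕜) ω‖
      ≤ ∑ k ∈ Finset.range n, ∑ j ∈ Finset.range (k + 1),
          ‖((T ^ (k - j)) (d j) : Ω →ₘ[μ] 𝕜) ω‖ := by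
        refine Finset.sum_le_sum fun k _ => ?_
        rw [hd k, hz k, add_zero]
        exact norm_sum_le _ _
    _ = ∑ j ∈ Finset.range n, ∑ i ∈ Finset.range (n - j),
          ‖((T ^ i) (d j) : Ω →ₘ[μ] 𝕜) ω‖ :=
        Finset.sum_range_diag_flip n fun j i => ‖((T ^ i) (d j) : Ω →ₘ[μ] 𝕜) ω‖
    _ ≤ ∑ j ∈ Finset.range n, ∑ i ∈ Finset.range n, ‖((T ^ i) (d j) : Ω →ₘ[μ] 𝕜) ω‖ :=
        Finset.sum_le_sum fun j _ => Finset.sum_le_sum_of_subset_of_nonneg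
          (Finset.range_mono (Nat.sub_le n j)) fun _ _ _ => norm_nonneg _
    _ = ∑ i ∈ Finset.range n, ∑ j ∈ Finset.range n, ‖((T ^ i) (d j) : Ω →ₘ[μ] 𝕜) ω‖ :=
        Finset.sum_comm
    _ ≤ ∑ _i ∈ Finset.range n, a := Finset.sum_le_sum fun i _ => hs i n
    _ = n * a := by simp

end IsDunfordSchwartz

/-! ### Weak type (2, 2) and contraction on L² -/

theorem coeFn_aesm (x : L1AddLinf 𝕜 μ) : AEStronglyMeasurable (x : Ω →ₘ[μ] 𝕜) μ :=
  AEEqFun.aestronglyMeasurable _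

theorem eLpNorm_two_sq {F : Type*} [NormedAddCommGroup F] (f : Ω → F) :
    eLpNorm f 2 μ ^ 2 = ∫⁻ ω, ‖f ω‖ₑ ^ 2 ∂μ := by
  simpa using eLpNorm_nnreal_pow_eq_lintegral (f := f) (μ := μ) (p := 2) two_ne_zero

theorem measurableSet_lt_norm (f : Ω →ₘ[μ] 𝕜) (a : ℝ) : MeasurableSet {ω | a < ‖f ω‖} :=
  measurableSet_lt measurable_const f.stronglyMeasurable.norm.measurable

/-- Truncation at the level `a`. -/
theorem exists_truncation (x : L1AddLinf 𝕜 μ) {a : ℝ} (ha : 0 ≤ a) :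
    ∃ u v : L1AddLinf 𝕜 μ, x = u + v ∧
      (u : Ω →ₘ[μ] 𝕜) =ᵐ[μ] {ω | a < ‖(x : Ω →ₘ[μ] 𝕜) ω‖}.indicator (x : Ω →ₘ[μ] 𝕜) ∧
      ∀ᵐ ω ∂μ, ‖(v : Ω →ₘ[μ] 𝕜) ω‖ ≤ a := by
  obtain ⟨u, hu⟩ := exists_coeFn_eq x
    ((coeFn_aesm x).indicator (measurableSet_lt_norm (x : Ω →ₘ[μ] 𝕜) a))
    (ae_of_all _ fun ω => norm_indicator_le_norm_self _ _)
  refine ⟨u, x - u, by abel, hu, ?_⟩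
  filter_upwards [hu, coeFn_sub_ae x u] with ω h1 h2
  rw [h2, h1]
  by_cases h : a < ‖(x : Ω →ₘ[μ] 𝕜) ω‖
  · rw [Set.indicator_of_mem (by exact h), sub_self, norm_zero]
    exact ha
  · rw [Set.indicator_of_notMem (by exact h), sub_zero]
    exact not_lt.1 h

theorem exists_simpleFunc_sum (φ : SimpleFunc Ω 𝕜) {x : L1AddLinf 𝕜 μ}
    (hx : (x : Ω →ₘ[μ] 𝕜) =ᵐ[μ] φ) :
    ∃ e : φ.range → L1AddLinf 𝕜 μ, x = ∑ c : φ.range, (c : 𝕜) • e c ∧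
      ∀ c, (e c : Ω →ₘ[μ] 𝕜) =ᵐ[μ] (φ ⁻¹' {(c : 𝕜)}).indicator fun _ => (1 : 𝕜) := by
  have h1 : ∀ c : φ.range, ∃ y : L1AddLinf 𝕜 μ,
      (y : Ω →ₘ[μ] 𝕜) =ᵐ[μ] (φ ⁻¹' {(c : 𝕜)}).indicator fun _ => (1 : 𝕜) := fun c =>
    exists_coeFn_eq_of_memLp_top
      ((memLp_top_const (1 : 𝕜)).indicator (φ.measurableSet_fiber c))
  choose e he using h1
  refine ⟨e, ext_ae ?_, he⟩
  filter_upwards [hx, coeFn_sum_ae Finset.univ fun c : φ.range => (c : 𝕜) • e c,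
    ae_all_iff.2 fun c : φ.range => coeFn_smul_ae (c : 𝕜) (e c), ae_all_iff.2 he] with ω h1 h2 h3 h4
  rw [h1, h2, Finset.sum_eq_single ⟨φ ω, φ.mem_range_self ω⟩]
  · rw [h3, h4, Set.indicator_of_mem (by simp), mul_one]
  · intro c _ hc
    rw [h3, h4, Set.indicator_of_notMem, mul_zero]
    intro h
    exact hc (Subtype.ext (by simpa using h.symm))
  · simp

namespace IsDunfordSchwartz

variable {T : Module.End 𝕜 (L1AddLinf 𝕜 μ)}

/-- The maximal inequality for a sum of a function in `L¹` and a bounded function. -/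
theorem measure_sum_norm_pow_add_gt_le (hT : IsDunfordSchwartz T) {x u v : L1AddLinf 𝕜 μ}
    (hx : x = u + v) {a b : ℝ} (ha : 0 < a) (hv : ∀ᵐ ω ∂μ, ‖(v : Ω →ₘ[μ] 𝕜) ω‖ ≤ b) :
    μ {ω | ∃ n : ℕ, n * (a + b) < ∑ k ∈ Finset.range n, ‖((T ^ k) x : Ω →ₘ[μ] 𝕜) ω‖}
      ≤ eLpNorm (u : Ω →ₘ[μ] 𝕜) 1 μ / ENNReal.ofReal a := by
  refine (measure_mono_ae ?_).trans (hT.measure_sum_norm_pow_gt_le u ha)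
  filter_upwards [ae_all_iff.2 fun k => (hT.pow k).ae_norm_le hv,
    ae_all_iff.2 fun k => coeFn_add_ae ((T ^ k) u) ((T ^ k) v)] with ω h1 h2
  rintro ⟨n, hn⟩
  refine ⟨n, ?_⟩
  have h3 : ∑ k ∈ Finset.range n, ‖((T ^ k) x : Ω →ₘ[μ] 𝕜) ω‖
      ≤ ∑ k ∈ Finset.range n, (‖((T ^ k) u : Ω →ₘ[μ] 𝕜) ω‖ + b) := by
    refine Finset.sum_le_sum fun k _ => ?_
    rw [hx, map_add, h2]
    exact (norm_add_le _ _).trans (add_le_add_right (h1 k) _)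
  rw [Finset.sum_add_distrib, Finset.sum_const, Finset.card_range, nsmul_eq_mul] at h3
  linarith

/-- The maximal inequality of weak type `(2, 2)`. -/
theorem measure_sum_norm_pow_gt_le_sq (hT : IsDunfordSchwartz T) (x : L1AddLinf 𝕜 μ) {a : ℝ}
    (ha : 0 < a) :
    μ {ω | ∃ n : ℕ, n * (a + a) < ∑ k ∈ Finset.range n, ‖((T ^ k) x : Ω →ₘ[μ] 𝕜) ω‖}
      ≤ (eLpNorm (x : Ω →ₘ[μ] 𝕜) 2 μ / ENNReal.ofReal a) ^ 2 := by
  obtain ⟨u, v, hx, hu, hv⟩ := exists_truncation x ha.le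
  have h0 : ENNReal.ofReal a ≠ 0 := by simpa using ha
  refine (hT.measure_sum_norm_pow_add_gt_le hx ha hv).trans ?_
  -- On {|x| > a}, which carries u, one has a |x| ≤ |x|².
  have h1 : eLpNorm (u : Ω →ₘ[μ] 𝕜) 1 μ * ENNReal.ofReal a
      ≤ eLpNorm (x : Ω →ₘ[μ] 𝕜) 2 μ ^ 2 := by
    rw [eLpNorm_one_eq_lintegral_enorm, eLpNorm_two_sq,
      ← lintegral_mul_const' _ _ ENNReal.ofReal_ne_top]
    refine lintegral_mono_ae ?_
    filter_upwards [hu] with ω h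
    rw [h]
    by_cases hω : a < ‖(x : Ω →ₘ[μ] 𝕜) ω‖
    · rw [Set.indicator_of_mem (by exact hω), sq, ← ofReal_norm]
      gcongr
    · rw [Set.indicator_of_notMem (by exact hω), enorm_zero, zero_mul]
      exact zero_le
  rw [ENNReal.div_le_iff h0 ENNReal.ofReal_ne_top, div_eq_mul_inv, mul_pow, mul_assoc, sq _⁻¹,
    mul_assoc, ENNReal.inv_mul_cancel h0 ENNReal.ofReal_ne_top, mul_one, ← div_eq_mul_inv,
    ENNReal.le_div_iff_mul_le (Or.inl h0) (Or.inl ENNReal.ofReal_ne_top)]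
  exact h1

/-- A Dunford–Schwartz operator is a contraction for the `L²`-norm on simple functions, by the
Schur test. -/
theorem eLpNorm_two_le_of_simpleFunc (hT : IsDunfordSchwartz T) (φ : SimpleFunc Ω 𝕜)
    {x : L1AddLinf 𝕜 μ} (hx : (x : Ω →ₘ[μ] 𝕜) =ᵐ[μ] φ) :
    eLpNorm (T x : Ω →ₘ[μ] 𝕜) 2 μ ≤ eLpNorm (x : Ω →ₘ[μ] 𝕜) 2 μ := by
  obtain ⟨e, hxe, he⟩ := exists_simpleFunc_sum φ hx
  have hTx : ∀ᵐ ω ∂μ, (T x : Ω →ₘ[μ] 𝕜) ω = ∑ c : φ.range, (c : 𝕜) * (T (e c) : Ω →ₘ[μ] 𝕜) ω := by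
    rw [hxe, map_sum]
    simp only [map_smul]
    filter_upwards [coeFn_sum_ae Finset.univ fun c : φ.range => (c : 𝕜) • T (e c),
      ae_all_iff.2 fun c : φ.range => coeFn_smul_ae (c : 𝕜) (T (e c))] with ω h1 h2
    rw [h1]
    simp only [h2]
  have hone : ∀ᵐ ω ∂μ, ∑ c, ‖(e c : Ω →ₘ[μ] 𝕜) ω‖ ≤ 1 := by
    filter_upwards [ae_all_iff.2 he] with ω h
    rw [Finset.sum_eq_single ⟨φ ω, φ.mem_range_self ω⟩]
    · rw [h, Set.indicator_of_mem (by simp), norm_one]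
    · intro c _ hc
      rw [h, Set.indicator_of_notMem, norm_zero]
      intro h
      exact hc (Subtype.ext (by simpa using h.symm))
    · simp
  have hpt : ∀ᵐ ω ∂μ, ‖(T x : Ω →ₘ[μ] 𝕜) ω‖ₑ ^ 2
      ≤ ∑ c : φ.range, ‖(c : 𝕜)‖ₑ ^ 2 * ‖(T (e c) : Ω →ₘ[μ] 𝕜) ω‖ₑ := by
    filter_upwards [hTx, hT.ae_sum_norm_le hone] with ω h1 h2
    -- Cauchy–Schwarz with the weights |T e_c|, whose sum is at most 1 because the indicators e_c of
    -- the fibres form a partition of unity.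
    have h3 : ‖(T x : Ω →ₘ[μ] 𝕜) ω‖ ^ 2
        ≤ ∑ c : φ.range, ‖(c : 𝕜)‖ ^ 2 * ‖(T (e c) : Ω →ₘ[μ] 𝕜) ω‖ := by
      rw [h1]
      calc ‖∑ c : φ.range, (c : 𝕜) * (T (e c) : Ω →ₘ[μ] 𝕜) ω‖ ^ 2
          ≤ (∑ c : φ.range, ‖(c : 𝕜) * (T (e c) : Ω →ₘ[μ] 𝕜) ω‖) ^ 2 := by
            gcongr
            exact norm_sum_le _ _
        _ ≤ (∑ c : φ.range, ‖(c : 𝕜)‖ ^ 2 * ‖(T (e c) : Ω →ₘ[μ] 𝕜) ω‖)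
            * ∑ c, ‖(T (e c) : Ω →ₘ[μ] 𝕜) ω‖ := by
            refine Finset.sum_sq_le_sum_mul_sum_of_sq_le_mul _ (fun _ _ => by positivity)
              (fun _ _ => norm_nonneg _) fun c _ => le_of_eq ?_
            rw [norm_mul]
            ring
        _ ≤ _ := mul_le_of_le_one_right (Finset.sum_nonneg fun _ _ => by positivity) h2
    calc ‖(T x : Ω →ₘ[μ] 𝕜) ω‖ₑ ^ 2
        = ENNReal.ofReal (‖(T x : Ω →ₘ[μ] 𝕜) ω‖ ^ 2) := by
          rw [ENNReal.ofReal_pow (norm_nonneg _), ofReal_norm]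
      _ ≤ ENNReal.ofReal (∑ c : φ.range, ‖(c : 𝕜)‖ ^ 2 * ‖(T (e c) : Ω →ₘ[μ] 𝕜) ω‖) :=
          ENNReal.ofReal_le_ofReal h3
      _ = _ := by
          rw [ENNReal.ofReal_sum_of_nonneg fun _ _ => by positivity]
          refine Finset.sum_congr rfl fun c _ => ?_
          rw [ENNReal.ofReal_mul (by positivity), ENNReal.ofReal_pow (norm_nonneg _),
            ofReal_norm, ofReal_norm]
  have hsq : eLpNorm (T x : Ω →ₘ[μ] 𝕜) 2 μ ^ 2 ≤ eLpNorm (x : Ω →ₘ[μ] 𝕜) 2 μ ^ 2 := by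
    rw [eLpNorm_two_sq, eLpNorm_two_sq]
    calc ∫⁻ ω, ‖(T x : Ω →ₘ[μ] 𝕜) ω‖ₑ ^ 2 ∂μ
        ≤ ∫⁻ ω, ∑ c : φ.range, ‖(c : 𝕜)‖ₑ ^ 2 * ‖(T (e c) : Ω →ₘ[μ] 𝕜) ω‖ₑ ∂μ :=
          lintegral_mono_ae hpt
      _ = ∑ c : φ.range, ‖(c : 𝕜)‖ₑ ^ 2 * ∫⁻ ω, ‖(T (e c) : Ω →ₘ[μ] 𝕜) ω‖ₑ ∂μ := by
          rw [lintegral_finsetSum' _ fun c _ => (coeFn_aesm _).enorm.const_mul _]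
          exact Finset.sum_congr rfl fun c _ => lintegral_const_mul'' _ (coeFn_aesm _).enorm
      _ ≤ ∑ c : φ.range, ‖(c : 𝕜)‖ₑ ^ 2 * ∫⁻ ω, ‖(e c : Ω →ₘ[μ] 𝕜) ω‖ₑ ∂μ := by
          exact Finset.sum_le_sum fun c _ => mul_le_mul_right (hT.lintegral_enorm_le (e c)) _
      _ = ∑ c : φ.range, ‖(c : 𝕜)‖ₑ ^ 2 * μ (φ ⁻¹' {(c : 𝕜)}) := by
          refine Finset.sum_congr rfl fun c _ => ?_
          congr 1
          rw [← lintegral_indicator_one (φ.measurableSet_fiber c)]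
          refine lintegral_congr_ae ?_
          filter_upwards [he c] with ω h
          rw [h, enorm_indicator_eq_indicator_enorm]
          simp [Pi.one_def]
      _ = ∑ c ∈ φ.range, ‖c‖ₑ ^ 2 * μ (φ ⁻¹' {c}) :=
          Finset.sum_coe_sort φ.range fun c => ‖c‖ₑ ^ 2 * μ (φ ⁻¹' {c})
      _ = ∫⁻ ω, ‖φ ω‖ₑ ^ 2 ∂μ := by
          rw [← SimpleFunc.map_lintegral (fun c : 𝕜 => ‖c‖ₑ ^ 2) φ,
            ← SimpleFunc.lintegral_eq_lintegral]
          rfl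
      _ = ∫⁻ ω, ‖(x : Ω →ₘ[μ] 𝕜) ω‖ₑ ^ 2 ∂μ := by
          refine lintegral_congr_ae ?_
          filter_upwards [hx] with ω h
          rw [h]
  exact (ENNReal.pow_le_pow_left_iff two_ne_zero).1 hsq

/-- A Dunford–Schwartz operator is a contraction for the `L²`-norm. -/
theorem eLpNorm_two_le (hT : IsDunfordSchwartz T) (x : L1AddLinf 𝕜 μ) :
    eLpNorm (T x : Ω →ₘ[μ] 𝕜) 2 μ ≤ eLpNorm (x : Ω →ₘ[μ] 𝕜) 2 μ := by
  by_cases htop : eLpNorm (x : Ω →ₘ[μ] 𝕜) 2 μ = ∞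
  · rw [htop]
    exact le_top
  have hx : MemLp (x : Ω →ₘ[μ] 𝕜) 2 μ := ⟨coeFn_aesm x, lt_top_iff_ne_top.2 htop⟩
  have hex : ∀ n : ℕ, ∃ y : L1AddLinf 𝕜 μ,
      eLpNorm ((x - y : L1AddLinf 𝕜 μ) : Ω →ₘ[μ] 𝕜) 2 μ ≤ ((n : ℝ≥0∞) + 1)⁻¹ ∧
      eLpNorm (T y : Ω →ₘ[μ] 𝕜) 2 μ ≤ eLpNorm (y : Ω →ₘ[μ] 𝕜) 2 μ := by
    intro n
    obtain ⟨φ, hφ, -⟩ := hx.exists_simpleFunc_eLpNorm_sub_lt (by simp)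
      (ε := ((n : ℝ≥0∞) + 1)⁻¹) (by simp [ENNReal.add_eq_top])
    obtain ⟨C, hC⟩ := φ.exists_forall_norm_le
    obtain ⟨y, hy⟩ := exists_coeFn_eq_of_memLp_top
      (memLp_top_of_bound φ.aestronglyMeasurable C (ae_of_all μ hC))
    refine ⟨y, ?_, hT.eLpNorm_two_le_of_simpleFunc φ hy⟩
    refine le_of_eq_of_le (eLpNorm_congr_ae ?_) hφ.le
    filter_upwards [coeFn_sub_ae x y, hy] with ω h1 h2
    rw [h1, h2, Pi.sub_apply]
  choose y hy hTy using hex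
  have h0 : Tendsto (fun n : ℕ => ((n : ℝ≥0∞) + 1)⁻¹) atTop (𝓝 0) := by
    have := (tendsto_add_atTop_iff_nat 1).2 ENNReal.tendsto_inv_nat_nhds_zero
    simpa using this
  -- Continuity of T on L² is not yet known. The weak type (2, 2) inequality gives convergence in
  -- measure, which suffices because the L² norm is lower semicontinuous for it.
  have hm : TendstoInMeasure μ (fun n => ⇑(T (y n) : Ω →ₘ[μ] 𝕜)) atTop
      (T x : Ω →ₘ[μ] 𝕜) := by
    rw [tendstoInMeasure_iff_norm]
    intro ε hε
    have hup : Tendsto (fun n : ℕ => (((n : ℝ≥0∞) + 1)⁻¹ / ENNReal.ofReal (ε / 8)) ^ 2) atTop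
        (𝓝 0) := by
      have h8 : ENNReal.ofReal (ε / 8) ≠ 0 := by simpa using by positivity
      have := ENNReal.Tendsto.pow (n := 2) (ENNReal.Tendsto.div_const h0 (Or.inr h8))
      simpa using this
    refine tendsto_of_tendsto_of_tendsto_of_le_of_le tendsto_const_nhds hup (fun _ => zero_le)
      fun n => ?_
    have h1 := hT.measure_sum_norm_pow_gt_le_sq (x - y n) (a := ε / 8) (by positivity)
    refine le_trans (measure_mono_ae ?_) (h1.trans (by gcongr; exact hy n))
    have hsub := coeFn_sub_ae (T x) (T (y n))
    rw [show T x - T (y n) = T (x - y n) from (map_sub T x (y n)).symm] at hsub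
    filter_upwards [hsub] with ω e
    intro hω
    -- The term k = 1 alone is at least ε, while the threshold for n = 2 is 2 (ε/8 + ε/8) = ε/2.
    refine ⟨2, ?_⟩
    rw [Finset.sum_range_succ, Finset.sum_range_one, pow_one, e, norm_sub_rev]
    have : ε ≤ ‖(T (y n) : Ω →ₘ[μ] 𝕜) ω - (T x : Ω →ₘ[μ] 𝕜) ω‖ := hω
    have := norm_nonneg (((T ^ 0) (x - y n) : Ω →ₘ[μ] 𝕜) ω)
    push_cast
    linarith
  refine ENNReal.le_of_forall_pos_le_add fun δ hδ _ => ?_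
  refine eLpNorm_le_of_tendstoInMeasure ?_ hm fun n => coeFn_aesm _
  have hδ' : (0 : ℝ≥0∞) < δ := by exact_mod_cast hδ
  filter_upwards [(tendsto_order.1 h0).2 _ hδ'] with n hn
  refine (hTy n).trans ?_
  calc eLpNorm (y n : Ω →ₘ[μ] 𝕜) 2 μ
      = eLpNorm ((x : Ω →ₘ[μ] 𝕜) - ((x - y n : L1AddLinf 𝕜 μ) : Ω →ₘ[μ] 𝕜) : Ω → 𝕜) 2 μ := by
        refine eLpNorm_congr_ae ?_
        filter_upwards [coeFn_sub_ae x (y n)] with ω e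
        rw [Pi.sub_apply, e, sub_sub_cancel]
    _ ≤ _ := (eLpNorm_sub_le (coeFn_aesm _) (coeFn_aesm _) (by norm_num)).trans
        (add_le_add_right ((hy n).trans hn.le) _)

end IsDunfordSchwartz

/-! ### Rotations on pairs -/

/-- The diagonal action of a linear operator on pairs, followed by the rotation of angle `θ`. -/
def rotate {M : Type*} [AddCommGroup M] [Module 𝕜 M] (T : Module.End 𝕜 M) (θ : ℝ) :
    Module.End 𝕜 (M × M) :=
  LinearMap.prod
    ((Real.cos θ : 𝕜) • (T ∘ₗ LinearMap.fst 𝕜 M M) - (Real.sin θ : 𝕜) • (T ∘ₗ LinearMap.snd 𝕜 M M))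
    ((Real.sin θ : 𝕜) • (T ∘ₗ LinearMap.fst 𝕜 M M) + (Real.cos θ : 𝕜) • (T ∘ₗ LinearMap.snd 𝕜 M M))

section Rotate

variable {M : Type*} [AddCommGroup M] [Module 𝕜 M]

theorem rotate_apply (T : Module.End 𝕜 M) (θ : ℝ) (w : M × M) :
    rotate T θ w = ((Real.cos θ : 𝕜) • T w.1 - (Real.sin θ : 𝕜) • T w.2,
      (Real.sin θ : 𝕜) • T w.1 + (Real.cos θ : 𝕜) • T w.2) := rfl

/-- Angles add because the rotation commutes with the diagonal action of T. Thus the orbit of (x, 0)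
is (cos (kθ) Tᵏ x, sin (kθ) Tᵏ x), and its unweighted averages are trigonometrically weighted
averages for T, with no complex scalars needed. -/
theorem rotate_pow (T : Module.End 𝕜 M) (θ : ℝ) (k : ℕ) :
    rotate T θ ^ k = rotate (T ^ k) (k * θ) := by
  induction k with
  | zero =>
    refine LinearMap.ext fun w => ?_
    simp [rotate_apply]
  | succ k ih =>
    refine LinearMap.ext fun w => ?_
    rw [pow_succ', Module.End.mul_apply, ih, rotate_apply, rotate_apply, rotate_apply]
    have h : ((k + 1 : ℕ) : ℝ) * θ = θ + k * θ := by
      push_cast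
      ring
    rw [h, Real.cos_add, Real.sin_add, pow_succ']
    simp only [Module.End.mul_apply, map_sub, map_add, map_smul, smul_sub, smul_add, smul_smul]
    push_cast
    refine Prod.ext ?_ ?_ <;> dsimp only <;> module

/-- Sums along the orbit of a fixed vector plus a coboundary plus a remainder. -/
theorem sum_pow_apply_of_eq {S : Module.End 𝕜 M} {x p q r : M} (hx : x = p + (q - S q) + r)
    (hp : S p = p) (n : ℕ) :
    ∑ k ∈ Finset.range n, (S ^ k) x
      = (n : 𝕜) • p + (q - (S ^ n) q) + ∑ k ∈ Finset.range n, (S ^ k) r := by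
  have hpk : ∀ k, (S ^ k) p = p := by
    intro k
    induction k with
    | zero => rfl
    | succ k ih => rw [pow_succ, Module.End.mul_apply, hp, ih]
  induction n with
  | zero => simp
  | succ n ih =>
    rw [Finset.sum_range_succ, ih, Finset.sum_range_succ, hx, map_add, map_add, map_sub, hpk,
      ← Module.End.mul_apply, ← pow_succ]
    push_cast
    rw [add_smul, one_smul]
    abel

theorem sum_map_rotate_pow_apply {T : Module.End 𝕜 M} {θ : ℝ} (π : M × M →ₗ[𝕜] M)
    {x p q r : M × M} (hx : x = p + (q - rotate T θ q) + r) (hp : rotate T θ p = p) (n : ℕ) :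
    ∑ k ∈ Finset.range n, π ((rotate T θ ^ k) x)
      = (n : 𝕜) • π p + (π q - π ((rotate T θ ^ n) q))
        + ∑ k ∈ Finset.range n, π ((rotate T θ ^ k) r) := by
  have := congrArg π (sum_pow_apply_of_eq hx hp n)
  simpa only [map_sum, map_add, map_sub, map_smul] using this

end Rotate

/-! ### Mean ergodic decomposition in Hilbert space -/

section Hilbert

variable {H : Type*} [NormedAddCommGroup H] [InnerProductSpace 𝕜 H] [CompleteSpace H]

/-- A form of the mean ergodic theorem: a vector is, up to a small remainder, the sum of a fixed
vector and a coboundary. -/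
theorem exists_fixed_add_coboundary (f : H →L[𝕜] H) (hf : ‖f‖ ≤ 1) (x : H) {δ : ℝ} (hδ : 0 < δ) :
    ∃ p q r : H, x = p + (q - f q) + r ∧ f p = p ∧ ‖r‖ < δ := by
  have hlim := f.tendsto_birkhoffAverage_orthogonalProjection hf x
  set p := (f.eqLocus (1 : H →L[𝕜] H)).orthogonalProjectionOnto x with hp
  obtain ⟨N, hN, hN1⟩ := ((Metric.tendsto_nhds.1 hlim δ hδ).and (eventually_ge_atTop 1)).exists
  -- The differences telescope, so x minus any Birkhoff average is an exact coboundary. The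
  -- remainder is the distance from the average to its limit p.
  have hmem : ∀ k, x - f^[k] x ∈ LinearMap.range (1 - (f : H →ₗ[𝕜] H)) := by
    intro k
    induction k with
    | zero => simp
    | succ k ih =>
      have : x - f^[k + 1] x = (x - f^[k] x) + (1 - (f : H →ₗ[𝕜] H)) (f^[k] x) := by
        rw [Function.iterate_succ_apply']
        simp
      rw [this]
      exact Submodule.add_mem _ ih ⟨_, rfl⟩
  have hq : x - birkhoffAverage 𝕜 f _root_.id N x ∈ LinearMap.range (1 - (f : H →ₗ[𝕜] H)) := by
    have hN0 : (N : 𝕜) ≠ 0 := by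
      exact_mod_cast (Nat.one_le_iff_ne_zero.1 hN1)
    have : x - birkhoffAverage 𝕜 f _root_.id N x
        = (N : 𝕜)⁻¹ • ∑ k ∈ Finset.range N, (x - f^[k] x) := by
      rw [Finset.sum_sub_distrib, smul_sub, Finset.sum_const, Finset.card_range,
        ← Nat.cast_smul_eq_nsmul 𝕜, smul_smul, inv_mul_cancel₀ hN0, one_smul]
      rfl
    rw [this]
    exact Submodule.smul_mem _ _ (Submodule.sum_mem _ fun k _ => hmem k)
  obtain ⟨q, hq⟩ := hq
  refine ⟨p, q, birkhoffAverage 𝕜 f _root_.id N x - p, ?_, ?_, ?_⟩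
  · have : q - f q = x - birkhoffAverage 𝕜 f _root_.id N x := hq
    rw [this]
    abel
  · exact p.2
  · rwa [← dist_eq_norm]

/-- The coefficients being real, the two cross terms are opposite multiples of re ⟪x, y⟫ and cancel.
-/
theorem norm_rotate_sq {H : Type*} [NormedAddCommGroup H] [InnerProductSpace 𝕜 H] (θ : ℝ)
    (x y : H) :
    ‖(Real.cos θ : 𝕜) • x - (Real.sin θ : 𝕜) • y‖ ^ 2
      + ‖(Real.sin θ : 𝕜) • x + (Real.cos θ : 𝕜) • y‖ ^ 2 = ‖x‖ ^ 2 + ‖y‖ ^ 2 := by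
  rw [@norm_sub_sq 𝕜, @norm_add_sq 𝕜, inner_smul_left, inner_smul_right, inner_smul_left,
    inner_smul_right, RCLike.conj_ofReal, RCLike.conj_ofReal, RCLike.re_ofReal_mul,
    RCLike.re_ofReal_mul, RCLike.re_ofReal_mul, RCLike.re_ofReal_mul, norm_smul, norm_smul,
    norm_smul, norm_smul]
  simp only [RCLike.norm_ofReal, mul_pow, sq_abs]
  linear_combination (‖x‖ ^ 2 + ‖y‖ ^ 2) * Real.sin_sq_add_cos_sq θ

/-- The ℓ² norm on the product makes it a Hilbert space on which the rotated operator is a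
contraction, so the mean ergodic decomposition applies. -/
theorem exists_rotate_fixed_add_coboundary (T : H →L[𝕜] H) (hT : ‖T‖ ≤ 1) (θ : ℝ) (x : H)
    {δ : ℝ} (hδ : 0 < δ) :
    ∃ p q r : H × H, (x, 0) = p + (q - rotate (T : H →ₗ[𝕜] H) θ q) + r ∧
      rotate (T : H →ₗ[𝕜] H) θ p = p ∧ ‖r.1‖ < δ ∧ ‖r.2‖ < δ := by
  let e := WithLp.linearEquiv 2 𝕜 (H × H)
  let S : WithLp 2 (H × H) →ₗ[𝕜] WithLp 2 (H × H) :=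
    e.symm.toLinearMap ∘ₗ rotate (T : H →ₗ[𝕜] H) θ ∘ₗ e.toLinearMap
  have hTn : ∀ y, ‖T y‖ ≤ ‖y‖ := fun y => by simpa using T.le_of_opNorm_le hT y
  have hS : ∀ w, ‖S w‖ ≤ 1 * ‖w‖ := by
    intro w
    rw [one_mul]
    refine (sq_le_sq₀ (norm_nonneg _) (norm_nonneg _)).1 ?_
    rw [WithLp.prod_norm_sq_eq_of_L2, WithLp.prod_norm_sq_eq_of_L2]
    refine (norm_rotate_sq θ (T w.fst) (T w.snd)).le.trans ?_
    gcongr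
    · exact hTn _
    · exact hTn _
  obtain ⟨p, q, r, h1, h2, h3⟩ := exists_fixed_add_coboundary (S.mkContinuous 1 hS)
    (S.mkContinuous_norm_le zero_le_one hS) (e.symm (x, 0)) hδ
  refine ⟨e p, e q, e r, ?_, ?_, ?_, ?_⟩
  · have := congrArg e h1
    simpa [S] using this
  · have := congrArg e h2
    simpa [S] using this
  · exact (WithLp.norm_fst_le (x := r)).trans_lt h3
  · exact (WithLp.norm_snd_le (x := r)).trans_lt h3

end Hilbert

/-! ### Approximation principle and the inclusion of L² -/

/-- Pointwise convergence from approximation by convergent sequences off sets of small measure. -/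
theorem ae_exists_tendsto_of_approx {F : ℕ → Ω → 𝕜}
    (h : ∀ ε : ℝ, 0 < ε → ∃ G : ℕ → Ω → 𝕜,
      (∀ᵐ ω ∂μ, ∃ l, Tendsto (fun n => G n ω) atTop (𝓝 l)) ∧
      μ {ω | ∃ n, ε < ‖F n ω - G n ω‖} ≤ ENNReal.ofReal ε) :
    ∀ᵐ ω ∂μ, ∃ l, Tendsto (fun n => F n ω) atTop (𝓝 l) := by
  have hpos : ∀ j : ℕ, (0 : ℝ) < (1 / 2) ^ j := fun j => by positivity
  -- The tolerances 2⁻ʲ are summable, so by Borel–Cantelli almost every point lies in only finitely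
  -- many of the bad sets.
  choose G hG hbad using fun j : ℕ => h ((1 / 2) ^ j) (hpos j)
  have hsum : ∑' j, μ {ω | ∃ n, (1 / 2 : ℝ) ^ j < ‖F n ω - G j n ω‖} ≠ ∞ := by
    refine ne_top_of_le_ne_top ?_ (ENNReal.tsum_le_tsum hbad)
    rw [← ENNReal.ofReal_tsum_of_nonneg (fun j => (hpos j).le)
      (summable_geometric_of_lt_one (by norm_num) (by norm_num))]
    exact ENNReal.ofReal_ne_top
  filter_upwards [ae_eventually_notMem hsum, ae_all_iff.2 hG] with ω h1 h2
  refine cauchySeq_tendsto_of_complete (Metric.cauchySeq_iff'.2 fun ε hε => ?_)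
  have hlim : Tendsto (fun j : ℕ => (1 / 2 : ℝ) ^ j) atTop (𝓝 0) :=
    tendsto_pow_atTop_nhds_zero_of_lt_one (by norm_num) (by norm_num)
  obtain ⟨j, hj, hjε⟩ := (h1.and ((tendsto_order.1 hlim).2 (ε / 3) (by positivity))).exists
  have hj' : ∀ n, ‖F n ω - G j n ω‖ ≤ (1 / 2) ^ j := by
    intro n
    by_contra hn
    exact hj ⟨n, not_le.1 hn⟩
  obtain ⟨l, hl⟩ := h2 j
  obtain ⟨N, hN⟩ := Metric.cauchySeq_iff'.1 hl.cauchySeq (ε / 3) (by positivity)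
  refine ⟨N, fun n hn => ?_⟩
  have e1 := hj' n
  have e2 := hj' N
  have e3 := hN n hn
  rw [← dist_eq_norm] at e1 e2
  have := dist_triangle4 (F n ω) (G j n ω) (G j N ω) (F N ω)
  rw [dist_comm (G j N ω)] at this
  linarith

theorem mem_L1AddLinf_of_memLp_two {f : Ω →ₘ[μ] 𝕜} (hf : MemLp f 2 μ) : f ∈ L1AddLinf 𝕜 μ := by
  have hA := measurableSet_lt_norm f 1
  have h1 : MemLp ({ω | 1 < ‖f ω‖}.indicator f) 1 μ := by
    refine ⟨hf.1.indicator hA, lt_of_le_of_lt ?_ (ENNReal.pow_lt_top hf.2 (n := 2))⟩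
    rw [eLpNorm_one_eq_lintegral_enorm, eLpNorm_two_sq]
    refine lintegral_mono fun ω => ?_
    by_cases hω : 1 < ‖f ω‖
    · rw [Set.indicator_of_mem (by exact hω), sq]
      refine le_mul_of_one_le_left zero_le ?_
      rw [← ofReal_norm]
      exact ENNReal.one_le_ofReal.2 hω.le
    · rw [Set.indicator_of_notMem (by exact hω), enorm_zero]
      exact zero_le
  have h2 : MemLp ({ω | 1 < ‖f ω‖}ᶜ.indicator f) ∞ μ := by
    refine memLp_top_of_bound (hf.1.indicator hA.compl) 1 (ae_of_all _ fun ω => ?_)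
    by_cases hω : 1 < ‖f ω‖
    · rw [Set.indicator_of_notMem (by simpa using hω), norm_zero]
      exact zero_le_one
    · rw [Set.indicator_of_mem (by exact hω)]
      exact not_lt.1 hω
  obtain ⟨u, hu⟩ := exists_coeFn_eq_of_memLp_one h1
  obtain ⟨v, hv⟩ := exists_coeFn_eq_of_memLp_top h2
  have : f = ((u + v : L1AddLinf 𝕜 μ) : Ω →ₘ[μ] 𝕜) := by
    apply AEEqFun.ext
    filter_upwards [hu, hv, coeFn_add_ae u v] with ω e1 e2 e3
    rw [e3, e1, e2, ← Pi.add_apply, Set.indicator_self_add_compl]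
  rw [this]
  exact (u + v).2

/-- The inclusion of `L²` into `L¹ + L^∞`. -/
def ofL2 (𝕜 : Type*) [RCLike 𝕜] (μ : Measure Ω) : Lp 𝕜 2 μ →ₗ[𝕜] L1AddLinf 𝕜 μ where
  toFun g := ⟨g.1, mem_L1AddLinf_of_memLp_two (Lp.memLp g)⟩
  map_add' _ _ := rfl
  map_smul' _ _ := rfl

theorem eLpNorm_ofL2_lt_top (g : Lp 𝕜 2 μ) :
    eLpNorm (ofL2 𝕜 μ g : Ω →ₘ[μ] 𝕜) 2 μ < ∞ := Lp.eLpNorm_lt_top g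

theorem eLpNorm_ofL2 (g : Lp 𝕜 2 μ) :
    eLpNorm (ofL2 𝕜 μ g : Ω →ₘ[μ] 𝕜) 2 μ = ENNReal.ofReal ‖g‖ := by
  rw [Lp.norm_def, ENNReal.ofReal_toReal (Lp.eLpNorm_ne_top g)]
  rfl

/-- The averages `(1/n) ∑_{k<n} α_k z_k`, with real weights. -/
def realAverage (α : ℕ → ℝ) (z : ℕ → 𝕜) (n : ℕ) : 𝕜 :=
  (n : 𝕜)⁻¹ * ∑ k ∈ Finset.range n, (α k : 𝕜) * z k

/-! ### Trigonometric weights on L² -/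

namespace IsDunfordSchwartz

variable {T : Module.End 𝕜 (L1AddLinf 𝕜 μ)}

/-- The restriction of a Dunford–Schwartz operator to `L²`. -/
theorem exists_clm_L2 (hT : IsDunfordSchwartz T) :
    ∃ S : Lp 𝕜 2 μ →L[𝕜] Lp 𝕜 2 μ, ‖S‖ ≤ 1 ∧ ∀ g, ofL2 𝕜 μ (S g) = T (ofL2 𝕜 μ g) := by
  have hlt : ∀ g : Lp 𝕜 2 μ, eLpNorm (T (ofL2 𝕜 μ g) : Ω →ₘ[μ] 𝕜) 2 μ < ∞ := fun g =>
    (hT.eLpNorm_two_le _).trans_lt (eLpNorm_ofL2_lt_top g)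
  let S : Lp 𝕜 2 μ →ₗ[𝕜] Lp 𝕜 2 μ :=
    { toFun := fun g => ⟨T (ofL2 𝕜 μ g), Lp.mem_Lp_iff_eLpNorm_lt_top.2 (hlt g)⟩
      map_add' := fun g h => Subtype.ext (by
        change (T (ofL2 𝕜 μ (g + h)) : Ω →ₘ[μ] 𝕜) = T (ofL2 𝕜 μ g) + T (ofL2 𝕜 μ h)
        rw [map_add, map_add]
        rfl)
      map_smul' := fun c g => Subtype.ext (by
        change (T (ofL2 𝕜 μ (c • g)) : Ω →ₘ[μ] 𝕜) = c • (T (ofL2 𝕜 μ g) : Ω →ₘ[μ] 𝕜)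
        rw [map_smul, map_smul]
        rfl) }
  have hS : ∀ g, ‖S g‖ ≤ 1 * ‖g‖ := by
    intro g
    rw [one_mul, Lp.norm_def, Lp.norm_def]
    exact ENNReal.toReal_mono (Lp.eLpNorm_ne_top g) (hT.eLpNorm_two_le _)
  exact ⟨S.mkContinuous 1 hS, S.mkContinuous_norm_le zero_le_one hS, fun g => rfl⟩

theorem exists_rotate_decomposition (hT : IsDunfordSchwartz T) (θ : ℝ) {x : L1AddLinf 𝕜 μ}
    (hx : eLpNorm (x : Ω →ₘ[μ] 𝕜) 2 μ < ∞) {δ : ℝ} (hδ : 0 < δ) :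
    ∃ p q r : L1AddLinf 𝕜 μ × L1AddLinf 𝕜 μ, (x, 0) = p + (q - rotate T θ q) + r ∧
      rotate T θ p = p ∧
      eLpNorm (q.1 : Ω →ₘ[μ] 𝕜) 2 μ < ∞ ∧ eLpNorm (q.2 : Ω →ₘ[μ] 𝕜) 2 μ < ∞ ∧
      eLpNorm (r.1 : Ω →ₘ[μ] 𝕜) 2 μ ≤ ENNReal.ofReal δ ∧
      eLpNorm (r.2 : Ω →ₘ[μ] 𝕜) 2 μ ≤ ENNReal.ofReal δ := by
  obtain ⟨S, hS, hST⟩ := hT.exists_clm_L2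
  obtain ⟨p, q, r, h1, h2, h3, h4⟩ := exists_rotate_fixed_add_coboundary S hS θ
    ⟨x, Lp.mem_Lp_iff_eLpNorm_lt_top.2 hx⟩ hδ
  let J := (ofL2 𝕜 μ).prodMap (ofL2 𝕜 μ)
  have hJ : ∀ w, J (rotate (S : Lp 𝕜 2 μ →ₗ[𝕜] Lp 𝕜 2 μ) θ w) = rotate T θ (J w) := by
    intro w
    simp [J, rotate_apply, hST]
  refine ⟨J p, J q, J r, ?_, ?_, eLpNorm_ofL2_lt_top _, eLpNorm_ofL2_lt_top _, ?_, ?_⟩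
  · have := congrArg J h1
    rw [map_add, map_add, map_sub, hJ] at this
    rw [← this]
    exact Prod.ext rfl (map_zero (ofL2 𝕜 μ)).symm
  · rw [← hJ, h2]
  · exact (eLpNorm_ofL2 r.1).trans_le (ENNReal.ofReal_le_ofReal h3.le)
  · exact (eLpNorm_ofL2 r.2).trans_le (ENNReal.ofReal_le_ofReal h4.le)

/-- Contraction on L² gives ∑ n⁻² ‖Tⁿ x‖₂² < ∞. Hence ∑ |Tⁿ x|² / n² is finite a.e. and its terms
tend to 0. -/
theorem ae_tendsto_norm_pow_div (hT : IsDunfordSchwartz T) {x : L1AddLinf 𝕜 μ}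
    (hx : eLpNorm (x : Ω →ₘ[μ] 𝕜) 2 μ < ∞) :
    ∀ᵐ ω ∂μ, Tendsto (fun n : ℕ => ‖((T ^ n) x : Ω →ₘ[μ] 𝕜) ω‖ / n) atTop (𝓝 0) := by
  have hm : ∀ n : ℕ, AEMeasurable (fun ω =>
      ENNReal.ofReal (1 / (n : ℝ) ^ 2) * ‖((T ^ n) x : Ω →ₘ[μ] 𝕜) ω‖ₑ ^ 2) μ := fun n =>
    ((coeFn_aesm _).enorm.pow_const 2).const_mul _
  have hint : ∫⁻ ω, ∑' n : ℕ,
      ENNReal.ofReal (1 / (n : ℝ) ^ 2) * ‖((T ^ n) x : Ω →ₘ[μ] 𝕜) ω‖ₑ ^ 2 ∂μ ≠ ∞ := by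
    rw [lintegral_tsum hm]
    refine ne_top_of_le_ne_top ?_ (ENNReal.tsum_le_tsum (g := fun n : ℕ =>
      ENNReal.ofReal (1 / (n : ℝ) ^ 2) * eLpNorm (x : Ω →ₘ[μ] 𝕜) 2 μ ^ 2) fun n => ?_)
    · rw [ENNReal.tsum_mul_right, ← ENNReal.ofReal_tsum_of_nonneg (fun n => by positivity)
        (Real.summable_one_div_nat_pow.2 one_lt_two)]
      exact ENNReal.mul_ne_top ENNReal.ofReal_ne_top (ENNReal.pow_ne_top hx.ne)
    · rw [lintegral_const_mul'' _ ((coeFn_aesm _).enorm.pow_const 2), ← eLpNorm_two_sq]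
      gcongr
      exact (hT.pow n).eLpNorm_two_le x
  filter_upwards [ae_lt_top' (AEMeasurable.tsum hm) hint] with ω hω
  have h1 := (ENNReal.tendsto_toReal ENNReal.zero_ne_top).comp
    (ENNReal.tendsto_atTop_zero_of_tsum_ne_top hω.ne)
  have h2 := (Real.continuous_sqrt.tendsto _).comp h1
  rw [ENNReal.toReal_zero, Real.sqrt_zero] at h2
  refine h2.congr fun n => ?_
  simp only [Function.comp_apply]
  rw [ENNReal.toReal_mul, ENNReal.toReal_ofReal (by positivity), ENNReal.toReal_pow, toReal_enorm,
    one_div_mul_eq_div, ← div_pow, Real.sqrt_sq (by positivity)]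

/-- The fixed part has constant averages, the coboundary contributes (q - Rⁿ q) / n → 0 with R the
rotated operator, and the remainder is uniformly small off a set of small measure. The map π stands
for either coordinate, so that the cosine and sine weights share one argument. -/
theorem ae_exists_tendsto_rotate (hT : IsDunfordSchwartz T) (θ : ℝ) {x : L1AddLinf 𝕜 μ}
    (hx : eLpNorm (x : Ω →ₘ[μ] 𝕜) 2 μ < ∞)
    (π : L1AddLinf 𝕜 μ × L1AddLinf 𝕜 μ →ₗ[𝕜] L1AddLinf 𝕜 μ)
    (hπ : ∀ k w, ∀ᵐ ω ∂μ, ‖(π ((rotate T θ ^ k) w) : Ω →ₘ[μ] 𝕜) ω‖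
      ≤ ‖((T ^ k) w.1 : Ω →ₘ[μ] 𝕜) ω‖ + ‖((T ^ k) w.2 : Ω →ₘ[μ] 𝕜) ω‖) :
    ∀ᵐ ω ∂μ, ∃ l, Tendsto (fun n : ℕ =>
      (n : 𝕜)⁻¹ * ∑ k ∈ Finset.range n, (π ((rotate T θ ^ k) (x, 0)) : Ω →ₘ[μ] 𝕜) ω)
      atTop (𝓝 l) := by
  refine ae_exists_tendsto_of_approx fun ε hε => ?_
  -- This choice gives η² ≤ ε/2. With remainder norms at most (ε/4) η, the weak type (2, 2) bound at
  -- a = ε/4 is η² for each coordinate; two exceptional sets of measure ε/2 and two averages of size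
  -- ε/2 add up to ε.
  set η : ℝ := min 1 (ε / 2) with hη
  have hη0 : 0 < η := lt_min one_pos (by positivity)
  obtain ⟨p, q, r, hpqr, hp, hq1, hq2, hr1, hr2⟩ :=
    hT.exists_rotate_decomposition θ hx (δ := ε / 4 * η) (by positivity)
  refine ⟨fun n ω => (n : 𝕜)⁻¹ * ((n : 𝕜) * (π p : Ω →ₘ[μ] 𝕜) ω + ((π q : Ω →ₘ[μ] 𝕜) ω
    - (π ((rotate T θ ^ n) q) : Ω →ₘ[μ] 𝕜) ω)), ?_, ?_⟩
  · filter_upwards [ae_all_iff.2 fun k => hπ k q, hT.ae_tendsto_norm_pow_div hq1,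
      hT.ae_tendsto_norm_pow_div hq2] with ω h2 h3 h4
    refine ⟨(π p : Ω →ₘ[μ] 𝕜) ω, ?_⟩
    have h5 : Tendsto (fun n : ℕ => (n : 𝕜)⁻¹ * (π ((rotate T θ ^ n) q) : Ω →ₘ[μ] 𝕜) ω)
        atTop (𝓝 0) := by
      refine squeeze_zero_norm (fun n => ?_) (by simpa using h3.add h4)
      rw [norm_mul, norm_inv, RCLike.norm_natCast, ← add_div, inv_mul_eq_div]
      gcongr
      exact h2 n
    have h6 : Tendsto (fun n : ℕ => (n : 𝕜)⁻¹ * (π q : Ω →ₘ[μ] 𝕜) ω) atTop (𝓝 0) := by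
      simpa using (tendsto_inv_atTop_nhds_zero_nat (𝕜 := 𝕜)).mul_const
        ((π q : Ω →ₘ[μ] 𝕜) ω)
    have h7 := ((tendsto_const_nhds (x := (π p : Ω →ₘ[μ] 𝕜) ω)).add h6).sub h5
    rw [add_zero, sub_zero] at h7
    refine h7.congr' ?_
    filter_upwards [eventually_ge_atTop 1] with n hn
    have hn0 : (n : 𝕜) ≠ 0 := by exact_mod_cast (Nat.one_le_iff_ne_zero.1 hn)
    rw [mul_add, ← mul_assoc, inv_mul_cancel₀ hn0]
    ring
  · have hb : ∀ y : L1AddLinf 𝕜 μ, eLpNorm (y : Ω →ₘ[μ] 𝕜) 2 μ ≤ ENNReal.ofReal (ε / 4 * η) →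
        μ {ω | ∃ n : ℕ, n * (ε / 4 + ε / 4)
          < ∑ k ∈ Finset.range n, ‖((T ^ k) y : Ω →ₘ[μ] 𝕜) ω‖} ≤ ENNReal.ofReal (ε / 2) := by
      intro y hy
      refine (hT.measure_sum_norm_pow_gt_le_sq y (a := ε / 4) (by positivity)).trans ?_
      calc (eLpNorm (y : Ω →ₘ[μ] 𝕜) 2 μ / ENNReal.ofReal (ε / 4)) ^ 2
          ≤ (ENNReal.ofReal (ε / 4 * η) / ENNReal.ofReal (ε / 4)) ^ 2 := by gcongr
        _ = ENNReal.ofReal (η ^ 2) := by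
          rw [← ENNReal.ofReal_div_of_pos (by positivity), mul_div_cancel_left₀ _ (by positivity),
            ENNReal.ofReal_pow hη0.le]
        _ ≤ ENNReal.ofReal (ε / 2) := by
          refine ENNReal.ofReal_le_ofReal ?_
          nlinarith [min_le_left 1 (ε / 2), min_le_right 1 (ε / 2)]
    have hrem : ∀ n : ℕ, ∀ᵐ ω ∂μ,
        ∑ k ∈ Finset.range n, (π ((rotate T θ ^ k) (x, 0)) : Ω →ₘ[μ] 𝕜) ω
          = ((n : 𝕜) * (π p : Ω →ₘ[μ] 𝕜) ω + ((π q : Ω →ₘ[μ] 𝕜) ω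
              - (π ((rotate T θ ^ n) q) : Ω →ₘ[μ] 𝕜) ω))
            + ∑ k ∈ Finset.range n, (π ((rotate T θ ^ k) r) : Ω →ₘ[μ] 𝕜) ω := by
      intro n
      have e0 := sum_map_rotate_pow_apply π hpqr hp n
      filter_upwards [coeFn_sum_ae (Finset.range n) fun k => π ((rotate T θ ^ k) (x, 0)),
        coeFn_sum_ae (Finset.range n) fun k => π ((rotate T θ ^ k) r),
        coeFn_add_ae ((n : 𝕜) • π p + (π q - π ((rotate T θ ^ n) q)))
          (∑ k ∈ Finset.range n, π ((rotate T θ ^ k) r)),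
        coeFn_add_ae ((n : 𝕜) • π p) (π q - π ((rotate T θ ^ n) q)),
        coeFn_smul_ae (n : 𝕜) (π p), coeFn_sub_ae (π q) (π ((rotate T θ ^ n) q))]
        with ω e1 e2 e3 e4 e5 e6
      rw [← e1, e0, e3, e2, e4, e5, e6]
    have hε2 : ENNReal.ofReal ε = ENNReal.ofReal (ε / 2) + ENNReal.ofReal (ε / 2) := by
      rw [← ENNReal.ofReal_add (by positivity) (by positivity), add_halves]
    rw [hε2]
    refine le_trans (measure_mono_ae ?_) ((measure_union_le _ _).trans
      (add_le_add (hb r.1 hr1) (hb r.2 hr2)))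
    filter_upwards [ae_all_iff.2 hrem, ae_all_iff.2 fun k => hπ k r] with ω h1 h2
    rintro ⟨n, hn⟩
    rw [h1, ← mul_sub, add_sub_cancel_left, norm_mul, norm_inv, RCLike.norm_natCast] at hn
    by_contra hcon
    have hcon1 : ¬ ∃ n : ℕ, n * (ε / 4 + ε / 4)
          < ∑ k ∈ Finset.range n, ‖((T ^ k) r.1 : Ω →ₘ[μ] 𝕜) ω‖ := fun h => hcon (Or.inl h)
    have hcon2 : ¬ ∃ n : ℕ, n * (ε / 4 + ε / 4)
          < ∑ k ∈ Finset.range n, ‖((T ^ k) r.2 : Ω →ₘ[μ] 𝕜) ω‖ := fun h => hcon (Or.inr h)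
    push Not at hcon1 hcon2
    have h3 : ‖∑ k ∈ Finset.range n, (π ((rotate T θ ^ k) r) : Ω →ₘ[μ] 𝕜) ω‖ ≤ n * ε := by
      refine (norm_sum_le _ _).trans ((Finset.sum_le_sum fun k _ => h2 k).trans ?_)
      rw [Finset.sum_add_distrib]
      linarith [hcon1 n, hcon2 n]
    refine hn.not_ge ?_
    rw [inv_mul_eq_div]
    exact div_le_of_le_mul₀ (Nat.cast_nonneg n) hε.le (by linarith)

/-- Convergence almost everywhere of the averages with the weights `cos (kθ)` and `sin (kθ)`. -/
theorem ae_exists_tendsto_cos_sin (hT : IsDunfordSchwartz T) (θ : ℝ) {x : L1AddLinf 𝕜 μ}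
    (hx : eLpNorm (x : Ω →ₘ[μ] 𝕜) 2 μ < ∞) :
    ∀ᵐ ω ∂μ,
      (∃ l, Tendsto (realAverage (fun k => Real.cos (k * θ))
        fun k => ((T ^ k) x : Ω →ₘ[μ] 𝕜) ω) atTop (𝓝 l)) ∧
      ∃ l, Tendsto (realAverage (fun k => Real.sin (k * θ))
        fun k => ((T ^ k) x : Ω →ₘ[μ] 𝕜) ω) atTop (𝓝 l) := by
  have hmul : ∀ (t : ℝ) (z : 𝕜), |t| ≤ 1 → ‖(t : 𝕜) * z‖ ≤ ‖z‖ := by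
    intro t z ht
    rw [norm_mul, RCLike.norm_ofReal]
    exact mul_le_of_le_one_left (norm_nonneg _) ht
  have h1 := hT.ae_exists_tendsto_rotate θ hx (LinearMap.fst 𝕜 _ _) fun k w => by
    rw [rotate_pow, rotate_apply]
    filter_upwards [coeFn_sub_ae ((Real.cos (k * θ) : 𝕜) • (T ^ k) w.1)
      ((Real.sin (k * θ) : 𝕜) • (T ^ k) w.2), coeFn_smul_ae (Real.cos (k * θ) : 𝕜) ((T ^ k) w.1),
      coeFn_smul_ae (Real.sin (k * θ) : 𝕜) ((T ^ k) w.2)] with ω e1 e2 e3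
    rw [LinearMap.fst_apply, e1, e2, e3]
    exact (norm_sub_le _ _).trans (add_le_add (hmul _ _ (Real.abs_cos_le_one _))
      (hmul _ _ (Real.abs_sin_le_one _)))
  have h2 := hT.ae_exists_tendsto_rotate θ hx (LinearMap.snd 𝕜 _ _) fun k w => by
    rw [rotate_pow, rotate_apply]
    filter_upwards [coeFn_add_ae ((Real.sin (k * θ) : 𝕜) • (T ^ k) w.1)
      ((Real.cos (k * θ) : 𝕜) • (T ^ k) w.2), coeFn_smul_ae (Real.sin (k * θ) : 𝕜) ((T ^ k) w.1),
      coeFn_smul_ae (Real.cos (k * θ) : 𝕜) ((T ^ k) w.2)] with ω e1 e2 e3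
    rw [LinearMap.snd_apply, e1, e2, e3]
    exact (norm_add_le _ _).trans (add_le_add (hmul _ _ (Real.abs_sin_le_one _))
      (hmul _ _ (Real.abs_cos_le_one _)))
  have h7 : ∀ k : ℕ, (rotate T θ ^ k) (x, 0)
      = ((Real.cos (k * θ) : 𝕜) • (T ^ k) x, (Real.sin (k * θ) : 𝕜) • (T ^ k) x) := by
    intro k
    rw [rotate_pow, rotate_apply, map_zero, smul_zero, smul_zero]
    exact Prod.ext (sub_zero ((Real.cos (k * θ) : 𝕜) • (T ^ k) x))
      (add_zero ((Real.sin (k * θ) : 𝕜) • (T ^ k) x))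
  filter_upwards [h1, h2,
    ae_all_iff.2 fun k : ℕ => coeFn_smul_ae (Real.cos (k * θ) : 𝕜) ((T ^ k) x),
    ae_all_iff.2 fun k : ℕ => coeFn_smul_ae (Real.sin (k * θ) : 𝕜) ((T ^ k) x)] with ω h3 h4 h5 h6
  simp only [h7, LinearMap.fst_apply, LinearMap.snd_apply, h5, h6] at h3 h4
  exact ⟨h3, h4⟩

end IsDunfordSchwartz

/-! ### Real weights, trigonometric polynomials and Besicovitch sequences -/

section RealAverage

variable {α α' : ℕ → ℝ} {z : ℕ → 𝕜}

theorem realAverage_sub_weights (n : ℕ) :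
    realAverage α z n - realAverage α' z n = realAverage (fun k => α k - α' k) z n := by
  simp only [realAverage, ← mul_sub, ← Finset.sum_sub_distrib, ← sub_mul, RCLike.ofReal_sub]

theorem realAverage_sum_weights {ι : Type*} (s : Finset ι) (c : ι → ℝ) (α : ι → ℕ → ℝ) (n : ℕ) :
    realAverage (fun k => ∑ j ∈ s, c j * α j k) z n
      = ∑ j ∈ s, (c j : 𝕜) * realAverage (α j) z n := by
  simp only [realAverage, RCLike.ofReal_sum, RCLike.ofReal_mul, Finset.sum_mul]
  rw [Finset.sum_comm, Finset.mul_sum]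
  refine Finset.sum_congr rfl fun j _ => ?_
  rw [Finset.mul_sum, Finset.mul_sum, Finset.mul_sum]
  exact Finset.sum_congr rfl fun k _ => by ring

theorem norm_realAverage_le {C : ℝ} (hα : ∀ k, |α k| ≤ C) (n : ℕ) :
    ‖realAverage α z n‖ ≤ (n : ℝ)⁻¹ * (C * ∑ k ∈ Finset.range n, ‖z k‖) := by
  rw [realAverage, norm_mul, norm_inv, RCLike.norm_natCast, Finset.mul_sum]
  refine mul_le_mul_of_nonneg_left ((norm_sum_le _ _).trans (Finset.sum_le_sum fun k _ => ?_))
    (by positivity)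
  rw [norm_mul, RCLike.norm_ofReal]
  exact mul_le_mul_of_nonneg_right (hα k) (norm_nonneg _)

theorem norm_realAverage_le_of_norm_le {M : ℝ} (hz : ∀ k, ‖z k‖ ≤ M) (n : ℕ) :
    ‖realAverage α z n‖ ≤ M * ((n : ℝ)⁻¹ * ∑ k ∈ Finset.range n, |α k|) := by
  rw [realAverage, norm_mul, norm_inv, RCLike.norm_natCast, mul_left_comm, Finset.mul_sum]
  refine mul_le_mul_of_nonneg_left ((norm_sum_le _ _).trans (Finset.sum_le_sum fun k _ => ?_))
    (by positivity)
  rw [norm_mul, RCLike.norm_ofReal, mul_comm]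
  exact mul_le_mul_of_nonneg_right (hz k) (abs_nonneg _)

/-- The weights for which the averages of a bounded sequence converge are closed for the Besicovitch
seminorm. -/
theorem exists_tendsto_realAverage_of_approx {M : ℝ} (hz : ∀ k, ‖z k‖ ≤ M)
    (h : ∀ ε : ℝ, 0 < ε → ∃ α' : ℕ → ℝ, (∃ l, Tendsto (realAverage α' z) atTop (𝓝 l)) ∧
      ∀ᶠ n : ℕ in atTop, (n : ℝ)⁻¹ * ∑ k ∈ Finset.range n, |α k - α' k| < ε) :
    ∃ l, Tendsto (realAverage α z) atTop (𝓝 l) := by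
  have hM : 0 ≤ M := (norm_nonneg _).trans (hz 0)
  refine cauchySeq_tendsto_of_complete (Metric.cauchySeq_iff'.2 fun ε hε => ?_)
  obtain ⟨α', ⟨l, hl⟩, hα'⟩ := h (ε / 3 / (M + 1)) (by positivity)
  obtain ⟨N₁, hN₁⟩ := Metric.cauchySeq_iff.1 hl.cauchySeq (ε / 3) (by positivity)
  obtain ⟨N₂, hN₂⟩ := eventually_atTop.1 hα'
  have hd : ∀ n ≥ N₂, dist (realAverage α z n) (realAverage α' z n) < ε / 3 := by
    intro n hn
    rw [dist_eq_norm, realAverage_sub_weights]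
    refine (norm_realAverage_le_of_norm_le hz n).trans_lt ?_
    have h1 := hN₂ n hn
    rw [lt_div_iff₀ (by positivity)] at h1
    have h2 : 0 ≤ (n : ℝ)⁻¹ * ∑ k ∈ Finset.range n, |α k - α' k| := by positivity
    linarith
  refine ⟨max N₁ N₂, fun n hn => ?_⟩
  have e1 := hd n ((le_max_right _ _).trans hn)
  have e2 := hd _ (le_max_right N₁ N₂)
  have e3 := hN₁ n ((le_max_left _ _).trans hn) _ (le_max_left N₁ N₂)
  have := dist_triangle4 (realAverage α z n) (realAverage α' z n)
    (realAverage α' z (max N₁ N₂)) (realAverage α z (max N₁ N₂))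
  rw [dist_comm (realAverage α' z (max N₁ N₂)) (realAverage α z _)] at this
  linarith

end RealAverage

theorem re_trigPolynomial {s : ℕ} (z : Fin s → ℂ) (l : Fin s → Circle) (k : ℕ) :
    (∑ j, z j * (l j : ℂ) ^ (k : ℤ)).re
      = ∑ j, (z j).re * Real.cos (k * Complex.arg (l j))
        - ∑ j, (z j).im * Real.sin (k * Complex.arg (l j)) := by
  rw [Complex.re_sum, ← Finset.sum_sub_distrib]
  refine Finset.sum_congr rfl fun j _ => ?_
  have : (l j : ℂ) ^ (k : ℤ) = Complex.exp ((k * Complex.arg (l j) : ℝ) * Complex.I) := by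
    conv_lhs => rw [← Complex.norm_mul_exp_arg_mul_I (l j : ℂ)]
    rw [Circle.norm_coe, Complex.ofReal_one, one_mul, zpow_natCast, ← Complex.exp_nat_mul]
    push_cast
    ring_nf
  rw [this, Complex.mul_re, Complex.exp_ofReal_mul_I_re, Complex.exp_ofReal_mul_I_im]

theorem IsTrigPolynomial.const_mul {P : ℤ → ℂ} (hP : IsTrigPolynomial P) (c : ℂ) :
    IsTrigPolynomial fun k => c * P k := by
  obtain ⟨s, z, l, h⟩ := hP
  refine ⟨s, fun j => c * z j, l, fun k => ?_⟩
  change c * P k = ∑ j, c * z j * (l j : ℂ) ^ k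
  rw [h, Finset.mul_sum]
  exact Finset.sum_congr rfl fun j _ => (mul_assoc _ _ _).symm

theorem IsTrigPolynomial.exists_bound {P : ℤ → ℂ} (hP : IsTrigPolynomial P) :
    ∃ C : ℝ, ∀ k, ‖P k‖ ≤ C := by
  obtain ⟨s, z, l, h⟩ := hP
  refine ⟨∑ j, ‖z j‖, fun k => ?_⟩
  rw [h]
  refine (norm_sum_le _ _).trans (Finset.sum_le_sum fun j _ => ?_)
  rw [norm_mul, norm_zpow, Circle.norm_coe, one_zpow, mul_one]

/-- Since re (-iβ) = im β, results on real parts of Besicovitch sequences transfer to imaginary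
parts. -/
theorem IsBoundedBesicovitch.neg_I_mul {β : ℕ → ℂ} (hβ : IsBoundedBesicovitch β) :
    IsBoundedBesicovitch fun k => -Complex.I * β k := by
  obtain ⟨⟨C, hC⟩, h⟩ := hβ
  refine ⟨⟨C, fun k => by simpa using hC k⟩, fun ε hε => ?_⟩
  obtain ⟨P, hP, hlim⟩ := h ε hε
  refine ⟨_, hP.const_mul (-Complex.I), ?_⟩
  simpa only [← mul_sub, norm_mul, norm_neg, Complex.norm_I, one_mul] using hlim

theorem IsBoundedBesicovitch.exists_eventually_lt {β : ℕ → ℂ} (hβ : IsBoundedBesicovitch β)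
    {ε : ℝ} (hε : 0 < ε) : ∃ P : ℤ → ℂ, IsTrigPolynomial P ∧
      ∀ᶠ n : ℕ in atTop, (n : ℝ)⁻¹ * ∑ k ∈ Finset.range n, |(β k).re - (P k).re| < ε := by
  obtain ⟨⟨C, hC⟩, h⟩ := hβ
  obtain ⟨P, hP, hlim⟩ := h ε hε
  obtain ⟨D, hD⟩ := hP.exists_bound
  refine ⟨P, hP, ?_⟩
  -- A real `limsup` controls the sequence eventually only if the sequence is bounded above.
  have hbdd : IsBoundedUnder (· ≤ ·) atTop
      fun n : ℕ => (1 / (n : ℝ)) * ∑ k ∈ Finset.range n, ‖β k - P k‖ := by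
    refine isBoundedUnder_of ⟨C + D, fun n => ?_⟩
    have hCD : 0 ≤ C + D := (norm_nonneg _).trans (norm_add_le_of_le (hC 0) (hD 0))
    have : ∑ k ∈ Finset.range n, ‖β k - P k‖ ≤ n * (C + D) := by
      refine (Finset.sum_le_sum fun k _ => (norm_sub_le_of_le (hC k) (hD k))).trans ?_
      simp [mul_add]
    rw [one_div_mul_eq_div]
    exact div_le_of_le_mul₀ (Nat.cast_nonneg n) hCD (by linarith)
  filter_upwards [eventually_lt_of_limsup_lt hlim hbdd] with n hn
  refine lt_of_le_of_lt ?_ hn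
  rw [one_div]
  refine mul_le_mul_of_nonneg_left (Finset.sum_le_sum fun k _ => ?_) (by positivity)
  rw [← Complex.sub_re]
  exact Complex.abs_re_le_norm _

theorem memLp_one_indicator_of_mem_L1AddLinf {f : Ω →ₘ[μ] 𝕜} (hf : f ∈ L1AddLinf 𝕜 μ) {A : Set Ω}
    (hA : MeasurableSet A) (hμA : μ A ≠ ∞) : MemLp (A.indicator f) 1 μ := by
  obtain ⟨a, b, ha, hb, rfl⟩ := exists_add_of_mem_L1AddLinf hf
  have h1 : MemLp (A.indicator a) 1 μ := ha.indicator hA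
  have h2 : MemLp (A.indicator b) 1 μ :=
    (hb.indicator hA).mono_exponent_of_measure_support_ne_top
      (fun x hx => Set.indicator_of_notMem hx _) hμA le_top
  refine (memLp_congr_ae ?_).1 (h1.add h2)
  filter_upwards [AEEqFun.coeFn_add a b] with ω h
  by_cases hω : ω ∈ A
  · simp [hω, h]
  · simp [hω]

/-! ### Almost everywhere convergence with Besicovitch weights -/

namespace IsDunfordSchwartz

variable {T : Module.End 𝕜 (L1AddLinf 𝕜 μ)}

theorem ae_exists_tendsto_trigPolynomial (hT : IsDunfordSchwartz T) {x : L1AddLinf 𝕜 μ}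
    (hx : eLpNorm (x : Ω →ₘ[μ] 𝕜) 2 μ < ∞) {P : ℤ → ℂ} (hP : IsTrigPolynomial P) :
    ∀ᵐ ω ∂μ, ∃ l, Tendsto (realAverage (fun k => (P k).re)
      fun k => ((T ^ k) x : Ω →ₘ[μ] 𝕜) ω) atTop (𝓝 l) := by
  obtain ⟨s, z, l, h⟩ := hP
  filter_upwards [ae_all_iff.2 fun j => hT.ae_exists_tendsto_cos_sin (Complex.arg (l j)) hx]
    with ω hω
  choose hc hs using hω
  choose lc hc using hc
  choose ls hs using hs
  have e : ∀ n, realAverage (fun k => (P k).re) (fun k => ((T ^ k) x : Ω →ₘ[μ] 𝕜) ω) n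
      = ∑ j, ((z j).re : 𝕜) * realAverage (fun k => Real.cos (k * Complex.arg (l j)))
          (fun k => ((T ^ k) x : Ω →ₘ[μ] 𝕜) ω) n
        - ∑ j, ((z j).im : 𝕜) * realAverage (fun k => Real.sin (k * Complex.arg (l j)))
          (fun k => ((T ^ k) x : Ω →ₘ[μ] 𝕜) ω) n := by
    intro n
    rw [← realAverage_sum_weights, ← realAverage_sum_weights, realAverage_sub_weights]
    simp only [h, re_trigPolynomial]
  refine ⟨∑ j, ((z j).re : 𝕜) * lc j - ∑ j, ((z j).im : 𝕜) * ls j, ?_⟩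
  refine Tendsto.congr (fun n => (e n).symm) ?_
  exact (tendsto_finsetSum _ fun j _ => (hc j).const_mul _).sub
    (tendsto_finsetSum _ fun j _ => (hs j).const_mul _)

/-- L^∞ contractivity bounds the whole orbit by M a.e., so an error in the weights costs at most M
times its Besicovitch seminorm. The countably many tolerances 1/(j + 1) keep the exceptional set
null. -/
theorem ae_exists_tendsto_of_bounded (hT : IsDunfordSchwartz T) {x : L1AddLinf 𝕜 μ}
    (hx : eLpNorm (x : Ω →ₘ[μ] 𝕜) 2 μ < ∞) {M : ℝ} (hM : ∀ᵐ ω ∂μ, ‖(x : Ω →ₘ[μ] 𝕜) ω‖ ≤ M)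
    {β : ℕ → ℂ} (hβ : IsBoundedBesicovitch β) :
    ∀ᵐ ω ∂μ, ∃ l, Tendsto (realAverage (fun k => (β k).re)
      fun k => ((T ^ k) x : Ω →ₘ[μ] 𝕜) ω) atTop (𝓝 l) := by
  choose P hP hPlt using fun j : ℕ => hβ.exists_eventually_lt (Nat.one_div_pos_of_nat (n := j))
  filter_upwards [ae_all_iff.2 fun j => hT.ae_exists_tendsto_trigPolynomial hx (hP j),
    ae_all_iff.2 fun k => (hT.pow k).ae_norm_le hM] with ω h1 h2
  refine exists_tendsto_realAverage_of_approx h2 fun ε hε => ?_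
  obtain ⟨j, hj⟩ := exists_nat_one_div_lt hε
  exact ⟨_, h1 j, (hPlt j).mono fun n hn => hn.trans hj⟩

/-- The weighted ergodic theorem for functions `x ∈ L¹ + L^∞` with `μ {|x| > a} < ∞` for
`a > 0`. -/
theorem ae_exists_tendsto_realAverage (hT : IsDunfordSchwartz T) {x : L1AddLinf 𝕜 μ}
    (hx : ∀ a : ℝ, 0 < a → μ {ω | a < ‖(x : Ω →ₘ[μ] 𝕜) ω‖} ≠ ∞)
    {β : ℕ → ℂ} (hβ : IsBoundedBesicovitch β) :
    ∀ᵐ ω ∂μ, ∃ l, Tendsto (realAverage (fun k => (β k).re)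
      fun k => ((T ^ k) x : Ω →ₘ[μ] 𝕜) ω) atTop (𝓝 l) := by
  obtain ⟨C, hC⟩ := hβ.1
  have hC0 : 0 ≤ C := (norm_nonneg _).trans (hC 0)
  have hre : ∀ k, |(β k).re| ≤ C := fun k => (Complex.abs_re_le_norm _).trans (hC k)
  refine ae_exists_tendsto_of_approx fun ε hε => ?_
  -- Chosen so that C (a + a) ≤ ε: one a is the level of the maximal inequality, the other the bound
  -- of the truncated part v.
  set a : ℝ := ε / (2 * (C + 1)) with ha
  have ha0 : 0 < a := by positivity
  obtain ⟨u, v, hxuv, hu, hv⟩ := exists_truncation x ha0.le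
  have hu1 : MemLp (u : Ω →ₘ[μ] 𝕜) 1 μ := (memLp_congr_ae hu).2
    (memLp_one_indicator_of_mem_L1AddLinf x.2 (measurableSet_lt_norm _ a) (hx a ha0))
  -- The error ε a in L¹, divided by the level a, gives an exceptional set of measure at most ε. An
  -- integrable simple function is bounded and lies in L².
  obtain ⟨φ, hφ, hφ1⟩ := hu1.exists_simpleFunc_eLpNorm_sub_lt (by simp)
    (ε := ENNReal.ofReal (ε * a)) (by simpa using by positivity)
  obtain ⟨M, hM⟩ := φ.exists_forall_norm_le
  obtain ⟨y, hy⟩ := exists_coeFn_eq_of_memLp_one hφ1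
  have hy2 : eLpNorm (y : Ω →ₘ[μ] 𝕜) 2 μ < ∞ := by
    rw [eLpNorm_congr_ae hy]
    exact ((SimpleFunc.memLp_iff_finMeasSupp (by simp) (by simp)).2
      ((SimpleFunc.memLp_iff_finMeasSupp (by simp) (by simp)).1 hφ1)).2
  have hyM : ∀ᵐ ω ∂μ, ‖(y : Ω →ₘ[μ] 𝕜) ω‖ ≤ M := by
    filter_upwards [hy] with ω h
    rw [h]
    exact hM ω
  refine ⟨fun n ω => realAverage (fun k => (β k).re) (fun k => ((T ^ k) y : Ω →ₘ[μ] 𝕜) ω) n,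
    hT.ae_exists_tendsto_of_bounded hy2 hyM hβ, ?_⟩
  have hxy : x - y = (u - y) + v := by
    rw [hxuv]
    abel
  have huy : eLpNorm ((u - y : L1AddLinf 𝕜 μ) : Ω →ₘ[μ] 𝕜) 1 μ ≤ ENNReal.ofReal (ε * a) := by
    refine le_of_eq_of_le (eLpNorm_congr_ae ?_) hφ.le
    filter_upwards [coeFn_sub_ae u y, hy] with ω h1 h2
    rw [h1, h2, Pi.sub_apply]
  refine (measure_mono_ae ?_).trans ((hT.measure_sum_norm_pow_add_gt_le hxy ha0 hv).trans ?_)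
  · have hsub : ∀ k, ∀ᵐ ω ∂μ, ((T ^ k) (x - y) : Ω →ₘ[μ] 𝕜) ω
        = ((T ^ k) x : Ω →ₘ[μ] 𝕜) ω - ((T ^ k) y : Ω →ₘ[μ] 𝕜) ω := by
      intro k
      rw [show (T ^ k) (x - y) = (T ^ k) x - (T ^ k) y from map_sub (T ^ k) x y]
      exact coeFn_sub_ae _ _
    filter_upwards [ae_all_iff.2 hsub] with ω hω
    rintro ⟨n, hn⟩
    refine ⟨n, ?_⟩
    by_contra hcon
    refine hn.not_ge ?_
    have e : realAverage (fun k => (β k).re) (fun k => ((T ^ k) x : Ω →ₘ[μ] 𝕜) ω) n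
        - realAverage (fun k => (β k).re) (fun k => ((T ^ k) y : Ω →ₘ[μ] 𝕜) ω) n
        = realAverage (fun k => (β k).re) (fun k => ((T ^ k) (x - y) : Ω →ₘ[μ] 𝕜) ω) n := by
      simp only [realAverage, ← mul_sub, ← Finset.sum_sub_distrib, hω]
    rw [e]
    refine (norm_realAverage_le hre n).trans ?_
    rw [inv_mul_eq_div]
    refine div_le_of_le_mul₀ (Nat.cast_nonneg n) hε.le ?_
    refine (mul_le_mul_of_nonneg_left (not_lt.1 hcon) hC0).trans ?_
    have h2 : C * (a + a) ≤ ε := by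
      rw [ha]
      have : C * (ε / (2 * (C + 1)) + ε / (2 * (C + 1))) = ε * (C / (C + 1)) := by
        field_simp
        ring
      rw [this]
      exact mul_le_of_le_one_right hε.le (div_le_one_of_le₀ (by linarith) (by positivity))
    calc C * (n * (a + a)) = n * (C * (a + a)) := by ring
      _ ≤ n * ε := mul_le_mul_of_nonneg_left h2 (Nat.cast_nonneg n)
      _ = ε * n := mul_comm _ _
  · refine ENNReal.div_le_of_le_mul (huy.trans ?_)
    rw [ENNReal.ofReal_mul hε.le]

end IsDunfordSchwartz

/-! ### Norm bounds for the limits -/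

/-- A limit of averages with weights bounded by `1` inherits the bounds of `L¹` and `L^∞`. -/
theorem eLpNorm_le_of_tendsto_realAverage {T : Module.End 𝕜 (L1AddLinf 𝕜 μ)} {x : L1AddLinf 𝕜 μ}
    {α : ℕ → ℝ} (hα : ∀ k, |α k| ≤ 1) {g : Ω → 𝕜} {p : ℝ≥0∞} (hp : 1 ≤ p)
    (hTp : ∀ k, eLpNorm ((T ^ k) x : Ω →ₘ[μ] 𝕜) p μ ≤ eLpNorm (x : Ω →ₘ[μ] 𝕜) p μ)
    (hg : ∀ᵐ ω ∂μ, Tendsto (realAverage α fun k => ((T ^ k) x : Ω →ₘ[μ] 𝕜) ω) atTop (𝓝 (g ω))) :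
    eLpNorm g p μ ≤ eLpNorm (x : Ω →ₘ[μ] 𝕜) p μ := by
  have hm : ∀ n k, AEStronglyMeasurable
      ((n : 𝕜)⁻¹ • (α k : 𝕜) • ⇑((T ^ k) x : Ω →ₘ[μ] 𝕜)) μ := fun n k =>
    ((coeFn_aesm _).const_smul _).const_smul _
  have he : ∀ n : ℕ, (fun ω => realAverage α (fun k => ((T ^ k) x : Ω →ₘ[μ] 𝕜) ω) n)
      = ∑ k ∈ Finset.range n, (n : 𝕜)⁻¹ • (α k : 𝕜) • ⇑((T ^ k) x : Ω →ₘ[μ] 𝕜) := by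
    intro n
    ext ω
    simp only [realAverage, Finset.mul_sum, Finset.sum_apply, Pi.smul_apply, smul_eq_mul]
  -- Lower semicontinuity of the norm reduces the bound to the averages themselves, with n ≥ 1 so
  -- that n⁻¹ cancels the number of terms.
  refine Lp.eLpNorm_le_of_ae_tendsto (f := fun n ω =>
    realAverage α (fun k => ((T ^ k) x : Ω →ₘ[μ] 𝕜) ω) n) (u := atTop) ?_ (fun n => ?_) hg
  · filter_upwards [eventually_ge_atTop 1] with n hn
    rw [he]
    refine (eLpNorm_sum_le (fun k _ => hm n k) hp).trans ?_
    calc ∑ k ∈ Finset.range n, eLpNorm ((n : 𝕜)⁻¹ • (α k : 𝕜) • ⇑((T ^ k) x : Ω →ₘ[μ] 𝕜)) p μ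
        ≤ ∑ _k ∈ Finset.range n, (n : ℝ≥0∞)⁻¹ * eLpNorm (x : Ω →ₘ[μ] 𝕜) p μ := by
          refine Finset.sum_le_sum fun k _ => ?_
          rw [eLpNorm_const_smul, eLpNorm_const_smul]
          have h1 : ‖(n : 𝕜)⁻¹‖ₑ = (n : ℝ≥0∞)⁻¹ := by
            rw [enorm_inv (by exact_mod_cast (Nat.one_le_iff_ne_zero.1 hn)), ← ofReal_norm,
              RCLike.norm_natCast, ENNReal.ofReal_natCast]
          have h2 : ‖(α k : 𝕜)‖ₑ ≤ 1 := by
            rw [← ofReal_norm, RCLike.norm_ofReal]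
            exact ENNReal.ofReal_le_one.2 (hα k)
          rw [h1]
          gcongr
          calc _ ≤ 1 * eLpNorm ((T ^ k) x : Ω →ₘ[μ] 𝕜) p μ := by gcongr
            _ ≤ _ := by
              rw [one_mul]
              exact hTp k
      _ = eLpNorm (x : Ω →ₘ[μ] 𝕜) p μ := by
          rw [Finset.sum_const, Finset.card_range, nsmul_eq_mul, ← mul_assoc,
            ENNReal.mul_inv_cancel (by exact_mod_cast (Nat.one_le_iff_ne_zero.1 hn))
            (ENNReal.natCast_ne_top n), one_mul]
  · rw [he]
    exact Finset.aestronglyMeasurable_sum _ fun k _ => hm n k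

/-! ### Integrals of the rearrangement -/

/-- Tonelli, applied to the indicator of {(l, t) : (l, G t) ∈ W}: each slice has length G t. Taking
W as {l < c} or {l ≤ c} gives both layer cake formulas. The strict one serves the upper estimate of
the rearrangement, the weak one the lower estimate. -/
theorem lintegral_eq_lintegral_meas_rel {ν : Measure ℝ} [SFinite ν] {G : ℝ → ℝ≥0∞}
    (hG : Measurable G) {W : Set (ℝ × ℝ≥0∞)} (hW : MeasurableSet W)
    (hc : ∀ c, (volume.restrict (Set.Ioi 0)) {l : ℝ | (l, c) ∈ W} = c) :
    ∫⁻ t, G t ∂ν = ∫⁻ l in Set.Ioi (0 : ℝ), ν {t | (l, G t) ∈ W} := by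
  have hm : Measurable (Function.uncurry fun t l : ℝ =>
      W.indicator (fun _ => (1 : ℝ≥0∞)) (l, G t)) :=
    (measurable_const.indicator hW).comp (measurable_snd.prodMk (hG.comp measurable_fst))
  calc ∫⁻ t, G t ∂ν
      = ∫⁻ t, (∫⁻ l in Set.Ioi (0 : ℝ), W.indicator (fun _ => (1 : ℝ≥0∞)) (l, G t)) ∂ν := by
        refine lintegral_congr fun t => ?_
        conv_lhs => rw [← hc (G t)]
        have hs : MeasurableSet {l : ℝ | (l, G t) ∈ W} := measurable_prodMk_right hW
        rw [← lintegral_indicator_one hs]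
        rfl
    _ = ∫⁻ l in Set.Ioi (0 : ℝ), ∫⁻ t, W.indicator (fun _ => (1 : ℝ≥0∞)) (l, G t) ∂ν :=
        lintegral_lintegral_swap hm.aemeasurable
    _ = _ := by
        refine lintegral_congr fun l => ?_
        have hs : MeasurableSet {t | (l, G t) ∈ W} := (measurable_const.prodMk hG) hW
        rw [← lintegral_indicator_one hs]
        rfl

/-- The layer cake formula for functions with values in `[0, ∞]`, with strict inequalities. -/
theorem lintegral_eq_lintegral_meas_ofReal_lt {ν : Measure ℝ} [SFinite ν] {G : ℝ → ℝ≥0∞}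
    (hG : Measurable G) :
    ∫⁻ t, G t ∂ν = ∫⁻ l in Set.Ioi (0 : ℝ), ν {t | ENNReal.ofReal l < G t} := by
  refine lintegral_eq_lintegral_meas_rel (W := {q | ENNReal.ofReal q.1 < q.2}) hG
    (measurableSet_lt (by fun_prop) measurable_snd) fun c => ?_
  change volume.restrict (Set.Ioi 0) {l : ℝ | ENNReal.ofReal l < c} = c
  rw [Measure.restrict_apply (measurableSet_lt (by fun_prop) measurable_const)]
  induction c with
  | top => simp
  | coe r =>
    have : {l : ℝ | ENNReal.ofReal l < r} ∩ Set.Ioi 0 = Set.Ioo 0 (r : ℝ) := by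
      ext l
      simp only [Set.mem_inter_iff, Set.mem_ofPred_eq, Set.mem_Ioi, Set.mem_Ioo]
      rw [and_comm, and_congr_right_iff]
      intro hl
      rw [ENNReal.ofReal_lt_coe_iff hl.le]
    exact (congrArg volume this).trans (by simp)

/-- The layer cake formula for functions with values in `[0, ∞]`, with weak inequalities. -/
theorem lintegral_eq_lintegral_meas_ofReal_le {ν : Measure ℝ} [SFinite ν] {G : ℝ → ℝ≥0∞}
    (hG : Measurable G) :
    ∫⁻ t, G t ∂ν = ∫⁻ l in Set.Ioi (0 : ℝ), ν {t | ENNReal.ofReal l ≤ G t} := by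
  refine lintegral_eq_lintegral_meas_rel (W := {q | ENNReal.ofReal q.1 ≤ q.2}) hG
    (measurableSet_le (by fun_prop) measurable_snd) fun c => ?_
  change volume.restrict (Set.Ioi 0) {l : ℝ | ENNReal.ofReal l ≤ c} = c
  rw [Measure.restrict_apply (measurableSet_le (by fun_prop) measurable_const)]
  induction c with
  | top => simp
  | coe r =>
    have : {l : ℝ | ENNReal.ofReal l ≤ r} ∩ Set.Ioi 0 = Set.Ioc 0 (r : ℝ) := by
      ext l
      simp only [Set.mem_inter_iff, Set.mem_ofPred_eq, Set.mem_Ioi, Set.mem_Ioc]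
      rw [and_comm, and_congr_right_iff]
      intro hl
      rw [ENNReal.ofReal_le_coe]
    exact (congrArg volume this).trans (by simp)

theorem rearrangement_antitone (f : Ω →ₘ[μ] 𝕜) : Antitone (rearrangement f) := fun _ _ hst =>
  sInf_le_sInf fun _ hl => ⟨hl.1, hl.2.trans (ENNReal.ofReal_le_ofReal hst)⟩

theorem measurable_rearrangement (f : Ω →ₘ[μ] 𝕜) : Measurable (rearrangement f) :=
  (rearrangement_antitone f).measurable

/-- If `μ {|f| ≥ l}` exceeds `t`, then `μ_t(f) ≥ l`. -/
theorem le_rearrangement {f : Ω →ₘ[μ] 𝕜} {t : ℝ} {l : ℝ≥0∞}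
    (h : ENNReal.ofReal t < μ {ω | l ≤ ‖f ω‖ₑ}) : l ≤ rearrangement f t := by
  refine le_sInf fun k hk => ?_
  by_contra hkl
  exact (h.trans_le ((measure_mono fun ω hω => (not_le.1 hkl).trans_le hω).trans hk.2)).false

/-- The estimate of `‖h‖₁ + s m` by the integral of the rearrangement, for the remainder `h` of the
truncation of `f` at the level `m = μ_s(f)`. -/
theorem lintegral_add_le_lintegral_rearrangement {f h : Ω →ₘ[μ] 𝕜} {s m : ℝ} (hs : 0 < s)
    (hm0 : 0 ≤ m) (hm : rearrangement f s = ENNReal.ofReal m)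
    (hh : ∀ᵐ ω ∂μ, h ω ≠ 0 → ‖f ω‖ = m + ‖h ω‖) :
    ∫⁻ ω, ‖h ω‖ₑ ∂μ + ENNReal.ofReal s * ENNReal.ofReal m
      ≤ ∫⁻ t in Set.Ioo 0 s, rearrangement f t := by
  have hge : ∀ t ∈ Set.Ioo 0 s, ENNReal.ofReal m ≤ rearrangement f t := fun t ht =>
    hm ▸ rearrangement_antitone f ht.2.le
  have hsplit : ∫⁻ t in Set.Ioo 0 s, rearrangement f t
      = (∫⁻ t in Set.Ioo 0 s, (rearrangement f t - ENNReal.ofReal m))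
        + ENNReal.ofReal s * ENNReal.ofReal m := by
    have hconst : ∫⁻ _ in Set.Ioo 0 s, ENNReal.ofReal m
        = ENNReal.ofReal s * ENNReal.ofReal m := by
      rw [setLIntegral_const, Real.volume_Ioo, sub_zero, mul_comm]
    rw [← hconst, ← lintegral_add_right _ measurable_const]
    exact setLIntegral_congr_fun measurableSet_Ioo fun t ht =>
      (tsub_add_cancel_of_le (hge t ht)).symm
  rw [hsplit]
  refine add_le_add_left ?_ _
  simp only [← ofReal_norm]
  rw [lintegral_eq_lintegral_meas_le μ (ae_of_all _ fun ω => norm_nonneg _)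
    h.aestronglyMeasurable.norm.aemeasurable,
    lintegral_eq_lintegral_meas_ofReal_le ((measurable_rearrangement f).sub_const _)]
  refine setLIntegral_mono' measurableSet_Ioi fun l hl => ?_
  have hl0 : 0 < l := hl
  -- With A = μ {|f| ≥ l + m}, the strict inequality l + m > μ_s(f) forces A ≤ s. For 0 < t < A one
  -- has μ_t(f) ≥ l + m, so the superlevel set of μ_t(f) - m at l contains (0, A).
  have hA : μ {ω | l ≤ ‖h ω‖} ≤ μ {ω | ENNReal.ofReal (l + m) ≤ ‖f ω‖ₑ} := by
    refine measure_mono_ae ?_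
    filter_upwards [hh] with ω hω
    intro hlω
    have hlω' : l ≤ ‖h ω‖ := hlω
    have h0 : h ω ≠ 0 := norm_pos_iff.1 (hl0.trans_le hlω')
    change ENNReal.ofReal (l + m) ≤ ‖f ω‖ₑ
    rw [← ofReal_norm, hω h0]
    exact ENNReal.ofReal_le_ofReal (by linarith)
  refine hA.trans ?_
  set A := μ {ω | ENNReal.ofReal (l + m) ≤ ‖f ω‖ₑ} with hAdef
  have hAs : A ≤ ENNReal.ofReal s := by
    have : rearrangement f s < ENNReal.ofReal (l + m) := by
      rw [hm]
      exact (ENNReal.ofReal_lt_ofReal_iff (by linarith)).2 (by linarith)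
    obtain ⟨k, hk, hkl⟩ := sInf_lt_iff.1 this
    exact (measure_mono fun ω hω => hkl.trans_le hω).trans hk.2
  have hAtop : A ≠ ∞ := ne_top_of_le_ne_top ENNReal.ofReal_ne_top hAs
  have hAs' : A.toReal ≤ s := ENNReal.toReal_le_of_le_ofReal hs.le hAs
  calc A = volume (Set.Ioo 0 A.toReal) := by
        rw [Real.volume_Ioo, sub_zero, ENNReal.ofReal_toReal hAtop]
    _ = volume.restrict (Set.Ioo 0 s) (Set.Ioo 0 A.toReal) := by
        rw [Measure.restrict_apply measurableSet_Ioo, Set.inter_eq_left.2]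
        exact Set.Ioo_subset_Ioo_right hAs'
    _ ≤ _ := by
        refine measure_mono fun t ht => ?_
        have h1 : ENNReal.ofReal (l + m) ≤ rearrangement f t :=
          le_rearrangement ((ENNReal.ofReal_lt_iff_lt_toReal ht.1.le hAtop).2 ht.2)
        change ENNReal.ofReal l ≤ rearrangement f t - ENNReal.ofReal m
        refine ENNReal.le_sub_of_add_le_right ENNReal.ofReal_ne_top ?_
        rwa [← ENNReal.ofReal_add hl0.le hm0]

theorem lintegral_rearrangement_le (f : Ω →ₘ[μ] 𝕜) (s : ℝ) :
    ∫⁻ t in Set.Ioo 0 s, rearrangement f t ≤ ∫⁻ ω, ‖f ω‖ₑ ∂μ := by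
  simp only [← ofReal_norm]
  rw [lintegral_eq_lintegral_meas_lt μ (ae_of_all _ fun ω => norm_nonneg _)
    f.aestronglyMeasurable.norm.aemeasurable,
    lintegral_eq_lintegral_meas_ofReal_lt (measurable_rearrangement f)]
  refine setLIntegral_mono' measurableSet_Ioi fun l hl => ?_
  have hl0 : 0 < l := hl
  have hsub : ∀ t, ENNReal.ofReal l < rearrangement f t →
      ENNReal.ofReal t < μ {ω | l < ‖f ω‖} := by
    intro t ht
    by_contra hcon
    refine ht.not_ge (sInf_le ⟨ENNReal.ofReal_pos.2 hl0, ?_⟩)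
    refine le_trans (measure_mono fun ω hω => ?_) (not_lt.1 hcon)
    have h1 : ENNReal.ofReal l < ‖f ω‖ₑ := hω
    rw [← ofReal_norm] at h1
    exact (ENNReal.ofReal_lt_ofReal_iff_of_nonneg hl0.le).1 h1
  by_cases htop : μ {ω | l < ‖f ω‖} = ∞
  · rw [htop]
    exact le_top
  calc volume.restrict (Set.Ioo 0 s) {t | ENNReal.ofReal l < rearrangement f t}
      ≤ volume (Set.Ioo 0 (μ {ω | l < ‖f ω‖}).toReal) := by
        rw [Measure.restrict_apply (measurableSet_lt measurable_const (measurable_rearrangement f))]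
        refine measure_mono fun t ht => ⟨ht.2.1, ?_⟩
        exact (ENNReal.ofReal_lt_iff_lt_toReal ht.2.1.le htop).1 (hsub t ht.1)
    _ = _ := by rw [Real.volume_Ioo, sub_zero, ENNReal.ofReal_toReal htop]

/-- The integral of the rearrangement is at most `‖u‖₁ + s ‖v‖_∞` if `f = u + v`. -/
theorem lintegral_rearrangement_le_add {f u v : Ω →ₘ[μ] 𝕜} (hf : ∀ᵐ ω ∂μ, f ω = u ω + v ω)
    {b : ℝ≥0∞} (hv : ∀ᵐ ω ∂μ, ‖v ω‖ₑ ≤ b) (s : ℝ) :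
    ∫⁻ t in Set.Ioo 0 s, rearrangement f t
      ≤ ∫⁻ ω, ‖u ω‖ₑ ∂μ + ENNReal.ofReal s * b := by
  have hpt : ∀ t, rearrangement f t ≤ rearrangement u t + b := by
    intro t
    conv_rhs => rw [rearrangement, ENNReal.sInf_add]
    refine le_iInf₂ fun l hl => sInf_le ⟨hl.1.trans_le le_self_add, ?_⟩
    refine le_trans (measure_mono_ae ?_) hl.2
    filter_upwards [hf, hv] with ω h1 h2
    intro hω
    have h3 : l + b < ‖f ω‖ₑ := hω
    change l < ‖u ω‖ₑ
    by_contra hcon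
    refine h3.not_ge ?_
    rw [h1]
    exact (enorm_add_le _ _).trans (add_le_add (not_lt.1 hcon) h2)
  calc ∫⁻ t in Set.Ioo 0 s, rearrangement f t
      ≤ ∫⁻ t in Set.Ioo 0 s, (rearrangement u t + b) := lintegral_mono fun t => hpt t
    _ = (∫⁻ t in Set.Ioo 0 s, rearrangement u t) + ENNReal.ofReal s * b := by
        rw [lintegral_add_right _ measurable_const, setLIntegral_const, Real.volume_Ioo, sub_zero,
          mul_comm]
    _ ≤ _ := add_le_add_left (lintegral_rearrangement_le u s) _

/-! ### Fully symmetric spaces: finite level sets and membership of the limit -/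

theorem one_mem_L1AddLinf : (1 : Ω →ₘ[μ] 𝕜) ∈ L1AddLinf 𝕜 μ :=
  mem_L1AddLinf_of_memLp_top ((memLp_congr_ae AEEqFun.coeFn_one).2 (memLp_top_const (1 : 𝕜)))

/-- If the constants do not belong to `E`, then the functions in `E` have level sets of finite
measure. -/
theorem FullySymmetricSpace.measure_lt_norm_ne_top (E : FullySymmetricSpace 𝕜 μ)
    (hE : (1 : Ω →ₘ[μ] 𝕜) ∉ E.carrier) {f : Ω →ₘ[μ] 𝕜} (hf : f ∈ E.carrier) {a : ℝ} (ha : 0 < a) :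
    μ {ω | a < ‖f ω‖} ≠ ∞ := by
  intro htop
  -- If {|f| > a} had infinite measure, the rearrangement of f / a would be at least 1 everywhere,
  -- while that of `1` is at most 1. So `1` would be submajorized by f / a and belong to E.
  have hg : ((a⁻¹ : ℝ) : 𝕜) • f ∈ E.carrier := Submodule.smul_mem _ _ hf
  refine hE (E.fully_symmetric ⟨_, hg⟩ 1 one_mem_L1AddLinf fun s hs => ?_).1
  refine lintegral_mono fun t => le_trans (b := 1) ?_ ?_
  · refine sInf_le ⟨one_pos, ?_⟩
    refine le_trans (le_of_eq (measure_eq_zero_iff_ae_notMem.2 ?_)) zero_le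
    filter_upwards [AEEqFun.coeFn_one (μ := μ) (β := 𝕜)] with ω h
    change ¬ 1 < ‖(1 : Ω →ₘ[μ] 𝕜) ω‖ₑ
    rw [h]
    simp
  · refine le_rearrangement (lt_of_lt_of_le ENNReal.ofReal_lt_top (htop.symm.trans_le ?_))
    refine measure_mono_ae ?_
    filter_upwards [AEEqFun.coeFn_smul ((a⁻¹ : ℝ) : 𝕜) f] with ω h
    intro hω
    have hω' : a < ‖f ω‖ := hω
    change 1 ≤ ‖(((a⁻¹ : ℝ) : 𝕜) • f : Ω →ₘ[μ] 𝕜) ω‖ₑ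
    rw [h, Pi.smul_apply, ← ofReal_norm, norm_smul, RCLike.norm_ofReal, abs_of_pos (inv_pos.2 ha),
      ENNReal.one_le_ofReal, inv_mul_eq_div, one_le_div ha]
    exact hω'.le

theorem exists_limit_realAverage {T : Module.End 𝕜 (L1AddLinf 𝕜 μ)} {α : ℕ → ℝ}
    {x : L1AddLinf 𝕜 μ} (h : ∀ᵐ ω ∂μ, ∃ l, Tendsto (realAverage α
      fun k => ((T ^ k) x : Ω →ₘ[μ] 𝕜) ω) atTop (𝓝 l)) :
    ∃ g : Ω →ₘ[μ] 𝕜, ∀ᵐ ω ∂μ, Tendsto (realAverage α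
      fun k => ((T ^ k) x : Ω →ₘ[μ] 𝕜) ω) atTop (𝓝 (g ω)) := by
  obtain ⟨g, hg, hlim⟩ := exists_stronglyMeasurable_limit_of_tendsto_ae (μ := μ)
    (f := fun n ω => realAverage α (fun k => ((T ^ k) x : Ω →ₘ[μ] 𝕜) ω) n) (fun n => by
      refine (Finset.aestronglyMeasurable_fun_sum _ fun k _ => ?_).const_mul _
      exact (coeFn_aesm _).const_mul _) h
  refine ⟨AEEqFun.mk g hg.aestronglyMeasurable, ?_⟩
  filter_upwards [hlim, AEEqFun.coeFn_mk g hg.aestronglyMeasurable] with ω h1 h2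
  rwa [h2]

theorem realAverage_add (α : ℕ → ℝ) (z w : ℕ → 𝕜) (n : ℕ) :
    realAverage α (fun k => z k + w k) n = realAverage α z n + realAverage α w n := by
  simp only [realAverage, mul_add, Finset.sum_add_distrib]

theorem realAverage_const_mul_weights (c : ℝ) (α : ℕ → ℝ) (z : ℕ → 𝕜) (n : ℕ) :
    realAverage (fun k => c * α k) z n = (c : 𝕜) * realAverage α z n := by
  simp only [realAverage, RCLike.ofReal_mul, mul_assoc, ← Finset.mul_sum]
  ring

theorem ae_eq_add_of_tendsto {T : Module.End 𝕜 (L1AddLinf 𝕜 μ)} {α : ℕ → ℝ}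
    {x u v : L1AddLinf 𝕜 μ} (hx : x = u + v) {g gu gv : Ω →ₘ[μ] 𝕜}
    (hg : ∀ᵐ ω ∂μ, Tendsto (realAverage α
      fun k => ((T ^ k) x : Ω →ₘ[μ] 𝕜) ω) atTop (𝓝 (g ω)))
    (hgu : ∀ᵐ ω ∂μ, Tendsto (realAverage α
      fun k => ((T ^ k) u : Ω →ₘ[μ] 𝕜) ω) atTop (𝓝 (gu ω)))
    (hgv : ∀ᵐ ω ∂μ, Tendsto (realAverage α
      fun k => ((T ^ k) v : Ω →ₘ[μ] 𝕜) ω) atTop (𝓝 (gv ω))) :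
    ∀ᵐ ω ∂μ, g ω = gu ω + gv ω := by
  filter_upwards [hg, hgu, hgv, ae_all_iff.2 fun k => coeFn_add_ae ((T ^ k) u) ((T ^ k) v)]
    with ω h1 h2 h3 h4
  refine tendsto_nhds_unique h1 ((h2.add h3).congr fun n => ?_)
  rw [← realAverage_add]
  congr 1
  ext k
  rw [← h4, hx, map_add]

/-- The limits of the averages of `f ∈ E` belong to `E`. -/
theorem FullySymmetricSpace.exists_limit_mem (E : FullySymmetricSpace 𝕜 μ)
    (hE : (1 : Ω →ₘ[μ] 𝕜) ∉ E.carrier) {T : Module.End 𝕜 (L1AddLinf 𝕜 μ)}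
    (hT : IsDunfordSchwartz T) {α : ℕ → ℝ} (hα : ∀ k, |α k| ≤ 1)
    (hconv : ∀ x : L1AddLinf 𝕜 μ, (∀ a : ℝ, 0 < a → μ {ω | a < ‖(x : Ω →ₘ[μ] 𝕜) ω‖} ≠ ∞) →
      ∀ᵐ ω ∂μ, ∃ l, Tendsto (realAverage α
        fun k => ((T ^ k) x : Ω →ₘ[μ] 𝕜) ω) atTop (𝓝 l))
    {f : Ω →ₘ[μ] 𝕜} (hf : f ∈ E.carrier) :
    ∃ g ∈ E.carrier, ∀ᵐ ω ∂μ, Tendsto (realAverage α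
      fun k => ((T ^ k) ⟨f, E.le_L1AddLinf hf⟩ : Ω →ₘ[μ] 𝕜) ω) atTop (𝓝 (g ω)) := by
  have hlev : ∀ x : L1AddLinf 𝕜 μ, (∀ᵐ ω ∂μ, ‖(x : Ω →ₘ[μ] 𝕜) ω‖ ≤ ‖f ω‖) →
      ∀ a : ℝ, 0 < a → μ {ω | a < ‖(x : Ω →ₘ[μ] 𝕜) ω‖} ≠ ∞ := by
    intro x hx a ha
    refine ne_top_of_le_ne_top (E.measure_lt_norm_ne_top hE hf ha) (measure_mono_ae ?_)
    filter_upwards [hx] with ω h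
    exact fun h' => lt_of_lt_of_le h' h
  have hlim := fun (x : L1AddLinf 𝕜 μ) hx => exists_limit_realAverage (hconv x (hlev x hx))
  have hT1 : ∀ (x : L1AddLinf 𝕜 μ) k,
      eLpNorm ((T ^ k) x : Ω →ₘ[μ] 𝕜) 1 μ ≤ eLpNorm (x : Ω →ₘ[μ] 𝕜) 1 μ :=
    fun x k => (hT.pow k).eLpNorm_one_le x
  have hTtop : ∀ (x : L1AddLinf 𝕜 μ) k,
      eLpNorm ((T ^ k) x : Ω →ₘ[μ] 𝕜) ∞ μ ≤ eLpNorm (x : Ω →ₘ[μ] 𝕜) ∞ μ :=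
    fun x k => (hT.pow k).eLpNorm_top_le x
  set x : L1AddLinf 𝕜 μ := ⟨f, E.le_L1AddLinf hf⟩ with hx
  -- the soft truncation of `f` at the level `m`, and the limits of its two parts
  have hdec : ∀ m : ℝ, 0 ≤ m → ∃ h v : L1AddLinf 𝕜 μ, x = v + h ∧
      (∀ᵐ ω ∂μ, ‖(v : Ω →ₘ[μ] 𝕜) ω‖ ≤ m) ∧
      (∀ᵐ ω ∂μ, ‖(v : Ω →ₘ[μ] 𝕜) ω‖ ≤ ‖f ω‖) ∧ (∀ᵐ ω ∂μ, ‖(h : Ω →ₘ[μ] 𝕜) ω‖ ≤ ‖f ω‖) ∧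
      ∀ᵐ ω ∂μ, (h : Ω →ₘ[μ] 𝕜) ω ≠ 0 → ‖f ω‖ = m + ‖(h : Ω →ₘ[μ] 𝕜) ω‖ := by
    intro m hm
    -- A filling step starting from the empty level 0 is a soft truncation: v has modulus min (|f|,
    -- m), and h is the excess with the same phase.
    obtain ⟨v, h, c', h1, h2, h3, h4, h5⟩ := exists_filling_step (a := m) x 0 (by
      filter_upwards [AEEqFun.coeFn_zero (μ := μ) (β := ℝ)] with ω h
      rwa [h])
    have h2' : ∀ᵐ ω ∂μ, c' ω = ‖(v : Ω →ₘ[μ] 𝕜) ω‖ := by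
      filter_upwards [h2, AEEqFun.coeFn_zero (μ := μ) (β := ℝ)] with ω e1 e2
      rw [e1, e2, Pi.zero_apply, zero_add]
    refine ⟨h, v, h1, ?_, ?_, ?_, ?_⟩
    · filter_upwards [h2', h3] with ω e1 e2
      rwa [← e1]
    · filter_upwards [h5] with ω e
      exact (le_add_of_nonneg_right (norm_nonneg _)).trans_eq e.symm
    · filter_upwards [h5] with ω e
      exact (le_add_of_nonneg_left (norm_nonneg _)).trans_eq e.symm
    · filter_upwards [h2', h4, h5] with ω e1 e2 e3 h0
      rw [← e2 h0, e1]
      exact e3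
  obtain ⟨g, hg⟩ := hlim x (ae_of_all _ fun ω => le_rfl)
  refine ⟨g, ?_, hg⟩
  -- Full symmetry applies only to elements of L¹ + L^∞. A hard truncation at level 1 suffices,
  -- since the limits of its two parts stay in L¹ and L^∞.
  have hgX : g ∈ L1AddLinf 𝕜 μ := by
    obtain ⟨u, v, hxuv, hu, hv⟩ := exists_truncation x zero_le_one
    have hu1 : MemLp (u : Ω →ₘ[μ] 𝕜) 1 μ := (memLp_congr_ae hu).2
      (memLp_one_indicator_of_mem_L1AddLinf x.2 (measurableSet_lt_norm _ 1)
        (E.measure_lt_norm_ne_top hE hf one_pos))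
    have hv1 : MemLp (v : Ω →ₘ[μ] 𝕜) ∞ μ := memLp_top_of_bound (coeFn_aesm v) 1 hv
    have huf : ∀ᵐ ω ∂μ, ‖(u : Ω →ₘ[μ] 𝕜) ω‖ ≤ ‖f ω‖ := by
      filter_upwards [hu] with ω h
      rw [h]
      exact norm_indicator_le_norm_self _ _
    have hvf : ∀ᵐ ω ∂μ, ‖(v : Ω →ₘ[μ] 𝕜) ω‖ ≤ ‖f ω‖ := by
      have hadd := coeFn_add_ae u v
      rw [← hxuv] at hadd
      filter_upwards [hu, hadd] with ω h1 h2
      rw [h1] at h2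
      by_cases hω : 1 < ‖f ω‖
      · rw [Set.indicator_of_mem (by exact hω), left_eq_add] at h2
        rw [h2, norm_zero]
        exact norm_nonneg _
      · rw [Set.indicator_of_notMem (by exact hω), zero_add] at h2
        rw [← h2]
    obtain ⟨gu, hgu⟩ := hlim u huf
    obtain ⟨gv, hgv⟩ := hlim v hvf
    have hgadd : g = gu + gv := by
      apply AEEqFun.ext
      filter_upwards [ae_eq_add_of_tendsto hxuv hg hgu hgv, AEEqFun.coeFn_add gu gv] with ω e1 e2
      rw [e1, e2, Pi.add_apply]
    rw [hgadd]
    exact Submodule.add_mem _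
      (mem_L1AddLinf_of_memLp_one ⟨gu.aestronglyMeasurable,
        (eLpNorm_le_of_tendsto_realAverage hα le_rfl (hT1 u) hgu).trans_lt hu1.2⟩)
      (mem_L1AddLinf_of_memLp_top ⟨gv.aestronglyMeasurable,
        (eLpNorm_le_of_tendsto_realAverage hα le_top (hTtop v) hgv).trans_lt hv1.2⟩)
  refine (E.fully_symmetric ⟨f, hf⟩ g hgX fun s hs => ?_).1
  -- An infinite μ_s(f) offers no truncation level, but then the right-hand side is infinite because
  -- μ_t(f) = ∞ for all t < s.
  by_cases htop : rearrangement f s = ∞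
  · refine le_top.trans_eq (Eq.symm ?_)
    rw [eq_top_iff]
    calc ∞ = ∫⁻ _ in Set.Ioo 0 s, ∞ := by
          rw [setLIntegral_const, Real.volume_Ioo, sub_zero, ENNReal.top_mul]
          simpa using hs
      _ ≤ _ := setLIntegral_mono' measurableSet_Ioo fun t ht =>
          htop.symm.trans_le (rearrangement_antitone f ht.2.le)
  set m := (rearrangement f s).toReal with hm
  have hm0 : 0 ≤ m := ENNReal.toReal_nonneg
  have hmr : rearrangement f s = ENNReal.ofReal m := (ENNReal.ofReal_toReal htop).symm
  obtain ⟨h, v, hxvh, hvm, hvf, hhf, hh⟩ := hdec m hm0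
  obtain ⟨gv, hgv⟩ := hlim v hvf
  obtain ⟨gh, hgh⟩ := hlim h hhf
  have hgadd := ae_eq_add_of_tendsto (hxvh.trans (add_comm v h)) hg hgh hgv
  have hgvm : ∀ᵐ ω ∂μ, ‖gv ω‖ₑ ≤ ENNReal.ofReal m := by
    have h1 := eLpNorm_le_of_tendsto_realAverage hα le_top (hTtop v) hgv
    rw [eLpNorm_exponent_top, eLpNorm_exponent_top] at h1
    filter_upwards [ae_le_eLpNormEssSup (f := gv) (μ := μ)] with ω hω
    exact hω.trans (h1.trans (eLpNormEssSup_le_of_ae_bound hvm))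
  have hgh1 : ∫⁻ ω, ‖gh ω‖ₑ ∂μ ≤ ∫⁻ ω, ‖(h : Ω →ₘ[μ] 𝕜) ω‖ₑ ∂μ := by
    have h1 := eLpNorm_le_of_tendsto_realAverage hα le_rfl (hT1 h) hgh
    rwa [eLpNorm_one_eq_lintegral_enorm, eLpNorm_one_eq_lintegral_enorm] at h1
  calc ∫⁻ t in Set.Ioo 0 s, rearrangement g t
      ≤ ∫⁻ ω, ‖gh ω‖ₑ ∂μ + ENNReal.ofReal s * ENNReal.ofReal m :=
        lintegral_rearrangement_le_add hgadd hgvm s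
    _ ≤ ∫⁻ ω, ‖(h : Ω →ₘ[μ] 𝕜) ω‖ₑ ∂μ + ENNReal.ofReal s * ENNReal.ofReal m :=
        add_le_add_left hgh1 _
    _ ≤ _ := lintegral_add_le_lintegral_rearrangement hs hm0 hmr hh

/-! ### From real to complex weights -/

/-- The weighted ergodic theorem in `E`, with the real parts of a Besicovitch sequence as
weights. -/
theorem FullySymmetricSpace.exists_mem_tendsto_realAverage (E : FullySymmetricSpace 𝕜 μ)
    (hE : (1 : Ω →ₘ[μ] 𝕜) ∉ E.carrier) {T : Module.End 𝕜 (L1AddLinf 𝕜 μ)}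
    (hT : IsDunfordSchwartz T) {f : Ω →ₘ[μ] 𝕜} (hf : f ∈ E.carrier)
    {β : ℕ → ℂ} (hβ : IsBoundedBesicovitch β) :
    ∃ g ∈ E.carrier, ∀ᵐ ω ∂μ, Tendsto (realAverage (fun k => (β k).re)
      fun k => ((T ^ k) ⟨f, E.le_L1AddLinf hf⟩ : Ω →ₘ[μ] 𝕜) ω) atTop (𝓝 (g ω)) := by
  obtain ⟨C, hC⟩ := hβ.1
  have hC0 : 0 ≤ C := (norm_nonneg _).trans (hC 0)
  have hC1 : C + 1 ≠ 0 := by positivity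
  -- Submajorization needs weights bounded by 1, hence the rescaling, undone on the limit. The
  -- divisor C + 1 is positive even when C = 0.
  obtain ⟨g, hgE, hg⟩ := E.exists_limit_mem hE hT (α := fun k => (C + 1)⁻¹ * (β k).re)
    (fun k => by
      rw [abs_mul, abs_of_pos (by positivity), inv_mul_le_one₀ (by positivity)]
      linarith [(Complex.abs_re_le_norm (β k)).trans (hC k)])
    (fun x hx => by
      filter_upwards [hT.ae_exists_tendsto_realAverage hx hβ] with ω hω
      obtain ⟨l, hl⟩ := hω
      refine ⟨_, (hl.const_mul (((C + 1)⁻¹ : ℝ) : 𝕜)).congr fun n => ?_⟩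
      rw [realAverage_const_mul_weights]) hf
  refine ⟨((C + 1 : ℝ) : 𝕜) • g, Submodule.smul_mem _ _ hgE, ?_⟩
  filter_upwards [hg, AEEqFun.coeFn_smul ((C + 1 : ℝ) : 𝕜) g] with ω h1 h2
  rw [h2]
  refine (h1.const_mul ((C + 1 : ℝ) : 𝕜)).congr fun n => ?_
  rw [realAverage_const_mul_weights, ← mul_assoc, ← RCLike.ofReal_mul, mul_inv_cancel₀ hC1,
    RCLike.ofReal_one, one_mul]

theorem FullySymmetricSpace.exists_mem_tendsto_realAverage_im (E : FullySymmetricSpace 𝕜 μ)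
    (hE : (1 : Ω →ₘ[μ] 𝕜) ∉ E.carrier) {T : Module.End 𝕜 (L1AddLinf 𝕜 μ)}
    (hT : IsDunfordSchwartz T) {f : Ω →ₘ[μ] 𝕜} (hf : f ∈ E.carrier)
    {β : ℕ → ℂ} (hβ : IsBoundedBesicovitch β) :
    ∃ g ∈ E.carrier, ∀ᵐ ω ∂μ, Tendsto (realAverage (fun k => (β k).im)
      fun k => ((T ^ k) ⟨f, E.le_L1AddLinf hf⟩ : Ω →ₘ[μ] 𝕜) ω) atTop (𝓝 (g ω)) := by
  simpa using E.exists_mem_tendsto_realAverage hE hT hf hβ.neg_I_mul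

theorem weightedAverage_eq (β z : ℕ → ℂ) (n : ℕ) :
    weightedAverage β z n = realAverage (fun k => (β k).re) z n
      + Complex.I * realAverage (fun k => (β k).im) z n := by
  have h : ∀ k, β k * z k = ((β k).re : ℂ) * z k + Complex.I * (((β k).im : ℂ) * z k) := by
    intro k
    conv_lhs => rw [← Complex.re_add_im (β k)]
    ring
  simp only [weightedAverage, h, Finset.sum_add_distrib, ← Finset.mul_sum]
  change _ = (n : ℂ)⁻¹ * ∑ k ∈ Finset.range n, ((β k).re : ℂ) * z k
    + Complex.I * ((n : ℂ)⁻¹ * ∑ k ∈ Finset.range n, ((β k).im : ℂ) * z k)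
  ring

theorem realAverage_ofReal (α x : ℕ → ℝ) (n : ℕ) :
    realAverage α (fun k => (x k : ℂ)) n = ((realAverage α x n : ℝ) : ℂ) := by
  change (n : ℂ)⁻¹ * ∑ k ∈ Finset.range n, (α k : ℂ) * (x k : ℂ)
    = (((n : ℝ)⁻¹ * ∑ k ∈ Finset.range n, α k * x k : ℝ) : ℂ)
  push_cast
  rfl

end FullySymmetric

end

/-- Weighted ergodic theorem in fully symmetric spaces `E` not containing the constant `1`, over
an infinite measure space. First part: `E` consists of real functions and `T` is a
Dunford–Schwartz operator; as the weights are complex, the limit is `u + i v` with `u, v ∈ E`, and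
it is `u ∈ E` if the weights are real. Second part: `E` consists of complex functions and `T` is a
positive Dunford–Schwartz operator. -/
theorem corollaryc41 {Ω : Type*} [MeasurableSpace Ω] (μ : Measure Ω) (hμ : μ Set.univ = ∞) :
    (∀ E : FullySymmetric.FullySymmetricSpace ℝ μ, (1 : Ω →ₘ[μ] ℝ) ∉ E.carrier →
      ∀ T : Module.End ℝ (FullySymmetric.L1AddLinf ℝ μ), FullySymmetric.IsDunfordSchwartz T →
      ∀ (f : Ω →ₘ[μ] ℝ) (hf : f ∈ E.carrier) (β : ℕ → ℂ),
      FullySymmetric.IsBoundedBesicovitch β →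
        ∃ u ∈ E.carrier, ∃ v ∈ E.carrier,
          (∀ᵐ ω ∂μ, Tendsto
            (FullySymmetric.weightedAverage β fun k =>
              ((((T ^ k) ⟨f, E.le_L1AddLinf hf⟩ : Ω →ₘ[μ] ℝ) ω : ℝ) : ℂ))
            atTop (𝓝 ((u ω : ℂ) + (v ω : ℂ) * Complex.I))) ∧
          ((∀ k, (β k).im = 0) → v = 0)) ∧
    (∀ E : FullySymmetric.FullySymmetricSpace ℂ μ, (1 : Ω →ₘ[μ] ℂ) ∉ E.carrier →
      ∀ T : Module.End ℂ (FullySymmetric.L1AddLinf ℂ μ), FullySymmetric.IsDunfordSchwartz T →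
      FullySymmetric.IsPositive T →
      ∀ (f : Ω →ₘ[μ] ℂ) (hf : f ∈ E.carrier) (β : ℕ → ℂ),
      FullySymmetric.IsBoundedBesicovitch β →
        ∃ fhat ∈ E.carrier,
          ∀ᵐ ω ∂μ, Tendsto
            (FullySymmetric.weightedAverage β fun k =>
              ((T ^ k) ⟨f, E.le_L1AddLinf hf⟩ : Ω →ₘ[μ] ℂ) ω)
            atTop (𝓝 (fhat ω))) := by
  constructor
  · intro E hE T hT f hf β hβ
    obtain ⟨u, hu, hulim⟩ := E.exists_mem_tendsto_realAverage hE hT hf hβ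
    obtain ⟨v, hv, hvlim⟩ := E.exists_mem_tendsto_realAverage_im hE hT hf hβ
    refine ⟨u, hu, v, hv, ?_, fun hβim => ?_⟩
    · filter_upwards [hulim, hvlim] with ω h1 h2
      rw [mul_comm (v ω : ℂ)]
      refine (((Complex.continuous_ofReal.tendsto _).comp h1).add
        (((Complex.continuous_ofReal.tendsto _).comp h2).const_mul Complex.I)).congr fun n => ?_
      rw [FullySymmetric.weightedAverage_eq, FullySymmetric.realAverage_ofReal,
        FullySymmetric.realAverage_ofReal]
      rfl
    · apply AEEqFun.ext
      filter_upwards [hvlim, AEEqFun.coeFn_zero (μ := μ) (β := ℝ)] with ω h1 h2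
      rw [h2]
      refine tendsto_nhds_unique h1 (tendsto_const_nhds.congr fun n => ?_)
      simp [FullySymmetric.realAverage, hβim]
  · intro E hE T hT _ f hf β hβ
    obtain ⟨u, hu, hulim⟩ := E.exists_mem_tendsto_realAverage hE hT hf hβ
    obtain ⟨v, hv, hvlim⟩ := E.exists_mem_tendsto_realAverage_im hE hT hf hβ
    refine ⟨u + Complex.I • v, E.carrier.add_mem hu (E.carrier.smul_mem _ hv), ?_⟩
    filter_upwards [hulim, hvlim, AEEqFun.coeFn_add u (Complex.I • v),
      AEEqFun.coeFn_smul Complex.I v] with ω h1 h2 h3 h4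
    rw [h3, Pi.add_apply, h4, Pi.smul_apply, smul_eq_mul]
    exact (h1.add (h2.const_mul Complex.I)).congr fun n =>
      (FullySymmetric.weightedAverage_eq _ _ _).symm
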